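/- **Theorem (rational representation of the components of the edge vectors).** Let $\mathcal G$ be a planar bicolored directed trivalent perfect (PBDTP) graph in the disk: a finite directed graph drawn with straight non-crossing edges in a closed disk (a compact convex plane region with non-empty interior), such that: the boundary vertices $b_1,\dots,b_n$ lie in clockwise order on a common straight interval of the boundary of the disk and have degree one; all other vertices are internal, lie strictly inside the disk, and are bivalent or trivalent; no component is isolated from the boundary; each internal vertex has exactly one incoming or exactly one outgoing edge; each internal vertex is white or black, and a trivalent vertex is white if it has only one incoming edge and black otherwise; each internal face (a face not reaching the boundary of the disk) has trivalent vertices of both colors; each $b_i$ is joined by its edge to a bivalent white internal vertex. A boundary vertex is a source (sink) if its edge is outgoing (incoming). Let $\mathfrak l$ be a gauge ray direction: the ray $b_i+\mathbb R_{\ge 0}\,\mathfrak l$ points inside the disk and contains no internal vertex, for every $i$, and no edge between internal vertices is parallel to $\mathfrak l$. For vectors $u,v$ of the plane let $s(u,v)\in\{1,0,-1\}$ be the sign of $u\wedge v$. For consecutive edges $e,f$ put $\mathrm{wind}(e,f)=\pm1$ if $s(e,f)=s(e,\mathfrak l)=s(\mathfrak l,f)=\pm1$, and $\mathrm{wind}(e,f)=0$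 otherwise. Let $\mathrm{int}(e)$ be the number of intersections of $e$ with the open rays $\{b_i+t\,\mathfrak l : t>0\}$ starting at the boundary sources $b_i$. Give every edge $e$ a weight $w_e$. For a directed walk $P=(e_1,\dots,e_m)$ put $\mathrm{wind}(P)=\sum_{k<m}\mathrm{wind}(e_k,e_{k+1})$, $\mathrm{int}(P)=\sum_k \mathrm{int}(e_k)$, $w(P)=\prod_k w_{e_k}$. For an edge $e$ and $j\in\{1,\dots,n\}$ let $$(E_e)_j=\sum_{P:\,e\to b_j}(-1)^{\mathrm{wind}(P)+\mathrm{int}(P)}\,w(P),$$ the sum over all directed walks with first edge $e$ and end point $b_j$; this is a formal power series in the weights. A conservative flow is a set $C$ of edges, none incident to the boundary, such that at each internal vertex as many edges of $C$ arrive as leave; $\mathcal C(\mathcal G)$ is the set of all of them, including $\emptyset$. An edge flow from $e=(V_1,V_2)$ to $b_j$ is a set $F$ of edges such that $e\in F$; at each internal vertex other than $V_1$ as many edges of $F$ arrive as leave; at $V_1$ the number of arriving edges is one less than the number of leaving ones; $F$ contains an edge ending at $b_j$, and, apart from it and possibly $e$, no edge incident to the boundary. $\mathcal F_{e,b_j}(\mathcal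 G)$ is the set of all of them. Put $w(C)=\prod_{f\in C}w_f$ and $w(F)=\prod_{f\in F}w_f$. Then each $F\in\mathcal F_{e,b_j}(\mathcal G)$ is the union of a walk $P_F$ from $e$ to $b_j$ without repeated edges and a conservative flow having no common edge with $P_F$, where $P_F$ is unique; put $\mathrm{wind}(F)=\mathrm{wind}(P_F)$ and $\mathrm{int}(F)=\mathrm{int}(P_F)$. For every edge $e$ and every $j$ (in particular, whenever $b_j$ is a sink and there is a directed walk from $e$ to $b_j$), $$(E_e)_j=\frac{\displaystyle\sum_{F\in\mathcal F_{e,b_j}(\mathcal G)}(-1)^{\mathrm{wind}(F)+\mathrm{int}(F)}\,w(F)}{\displaystyle\sum_{C\in\mathcal C(\mathcal G)}w(C)}$$ as formal power series in the weights, and the denominator is a polynomial with non-negative coefficients and constant term $1$. Moreover: (i) at arbitrary positive weights the denominator is positive, and the value of the rational function represented by the series $(E_e)_j$ is the right-hand side; (ii) at all positive weights for which the sum over walks converges (unconditionally), its sum is the right-hand side; (iii) the sum over walks converges at all sufficiently small positive weights. -/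

import Mathlib

noncomputable section

/-- The two colours of the internal vertices. -/
inductive VColor
  | white
  | black

/-- The oriented area `u ∧ v` of two vectors of the plane; it is positive if and only if the
ordered pair `(u, v)` is positively oriented, and zero if and only if `u`, `v` are collinear. -/
def planeCross (u v : ℝ × ℝ) : ℝ := u.1 * v.2 - u.2 * v.1

/-- A planar bicolored directed trivalent perfect graph in the disk, with boundary vertices
`b_i` (`Sum.inl i`, `i : Fin n`), internal vertices `V` (`Sum.inr v`) and oriented edges `E`,
drawn in the plane with straight edges. -/
structure PBDTPGraph (n : ℕ) (V E : Type*) [Fintype V] [Fintype E] where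
  /-- initial vertex of an edge -/
  src : E → Fin n ⊕ V
  /-- final vertex of an edge -/
  tgt : E → Fin n ⊕ V
  /-- colour of an internal vertex -/
  color : V → VColor
  /-- the closed disk, realised as a convex body -/
  disk : Set (ℝ × ℝ)
  /-- position of the vertices -/
  pos : Fin n ⊕ V → ℝ × ℝ
  disk_convex : Convex ℝ disk
  disk_compact : IsCompact disk
  disk_interior : (interior disk).Nonempty
  pos_injective : Function.Injective pos
  src_ne_tgt : ∀ e, src e ≠ tgt e
  /-- planarity: two distinct edges can meet only at common end points -/
  planar : ∀ e f, e ≠ f →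
    Disjoint (openSegment ℝ (pos (src e)) (pos (tgt e))) (segment ℝ (pos (src f)) (pos (tgt f)))
  /-- the internal vertices are strictly inside the disk -/
  internal_mem : ∀ v, pos (Sum.inr v) ∈ interior disk
  /-- the boundary vertices lie, in clockwise order, on a common straight interval of the
  boundary of the disk (running from `p` to `q`, the disk lies on the right) -/
  boundary_clockwise : ∃ (p q : ℝ × ℝ) (t : Fin n → ℝ),
    segment ℝ p q ⊆ frontier disk ∧
    (∀ x ∈ interior disk, planeCross (q - p) (x - p) < 0) ∧
    StrictMono t ∧
    ∀ i, t i ∈ Set.Icc (0 : ℝ) 1 ∧ pos (Sum.inl i) = p + t i • (q - p)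
  /-- no component of the graph is isolated from the boundary -/
  connected_to_boundary : ∀ v, ∃ i,
    Relation.EqvGen (fun x y => ∃ e, src e = x ∧ tgt e = y) (Sum.inr v) (Sum.inl i)
  /-- each boundary vertex has degree one -/
  boundary_degree : ∀ i, {e | src e = Sum.inl i ∨ tgt e = Sum.inl i}.ncard = 1
  /-- each internal vertex is bivalent or trivalent -/
  internal_degree : ∀ v,
    {e | src e = Sum.inr v ∨ tgt e = Sum.inr v}.ncard = 2 ∨
    {e | src e = Sum.inr v ∨ tgt e = Sum.inr v}.ncard = 3
  /-- perfectness: exactly one incoming edge or exactly one outgoing edge -/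
  perfect : ∀ v, {e | tgt e = Sum.inr v}.ncard = 1 ∨ {e | src e = Sum.inr v}.ncard = 1
  /-- a trivalent vertex is white if and only if it has only one incoming edge -/
  color_trivalent : ∀ v, {e | src e = Sum.inr v ∨ tgt e = Sum.inr v}.ncard = 3 →
    (color v = VColor.white ↔ {e | tgt e = Sum.inr v}.ncard = 1)
  /-- each internal face (a connected component of the complement of the graph in the open disk
  that does not reach the boundary of the disk) has trivalent vertices of both colours -/
  internal_face : ∀ x ∈ interior disk \ ⋃ e, segment ℝ (pos (src e)) (pos (tgt e)),
    ∀ Ω, Ω = connectedComponentIn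
        (interior disk \ ⋃ e, segment ℝ (pos (src e)) (pos (tgt e))) x →
      Disjoint (closure Ω) (frontier disk) →
      ∀ c, ∃ v, color v = c ∧
        {e | src e = Sum.inr v ∨ tgt e = Sum.inr v}.ncard = 3 ∧ pos (Sum.inr v) ∈ closure Ω
  /-- each boundary vertex is joined by its edge to a bivalent white internal vertex -/
  boundary_joined : ∀ i, ∃ v,
    color v = VColor.white ∧ {e | src e = Sum.inr v ∨ tgt e = Sum.inr v}.ncard = 2 ∧
    ∃ e, (src e = Sum.inl i ∧ tgt e = Sum.inr v) ∨ (src e = Sum.inr v ∧ tgt e = Sum.inl i)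

namespace PBDTPGraph

variable {n : ℕ} {V E : Type*} [Fintype V] [Fintype E]

/-- `b_i` is a boundary source. -/
def IsSource (G : PBDTPGraph n V E) (i : Fin n) : Prop := ∃ e, G.src e = Sum.inl i

/-- The vector of an oriented edge. -/
def dir (G : PBDTPGraph n V E) (e : E) : ℝ × ℝ := G.pos (G.tgt e) - G.pos (G.src e)

/-- Gauge ray directions: the rays starting at the boundary vertices point inside the disk,
no edge joining internal vertices is parallel to the direction, and the rays starting at the
boundary vertices contain no internal vertex. -/
structure IsGaugeDirection (G : PBDTPGraph n V E) (l : ℝ × ℝ) : Prop where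
  points_inside : ∀ i, ∃ t : ℝ, 0 < t ∧ G.pos (Sum.inl i) + t • l ∈ interior G.disk
  not_parallel : ∀ e u v, G.src e = Sum.inr u → G.tgt e = Sum.inr v → planeCross (G.dir e) l ≠ 0
  no_vertex : ∀ i v, ∀ t : ℝ, 0 ≤ t → G.pos (Sum.inl i) + t • l ≠ G.pos (Sum.inr v)

/-- `s(u, v)`: `1` if the pair is positively oriented, `-1` if it is negatively oriented, `0` if the
vectors are parallel. (Consecutive edges of a straight planar drawing are never antiparallel.) -/
def orient (u v : ℝ × ℝ) : ℤ := SignType.sign (planeCross u v)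

/-- The local winding number of an ordered pair of oriented edges. -/
def windPair (G : PBDTPGraph n V E) (l : ℝ × ℝ) (e f : E) : ℤ :=
  if orient (G.dir e) (G.dir f) = 1 ∧ orient (G.dir e) l = 1 ∧ orient l (G.dir f) = 1 then 1
  else if orient (G.dir e) (G.dir f) = -1 ∧ orient (G.dir e) l = -1 ∧ orient l (G.dir f) = -1
    then -1
  else 0

/-- The generalized winding number of a sequence of edges: the sum of the local winding numbers of
its consecutive pairs. -/
def wind (G : PBDTPGraph n V E) (l : ℝ × ℝ) : List E → ℤ
  | [] => 0
  | [_] => 0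
  | e :: f :: P => G.windPair l e f + wind G l (f :: P)

/-- The open gauge ray `{b_i + t l : t > 0}`. -/
def gaugeRay (G : PBDTPGraph n V E) (l : ℝ × ℝ) (i : Fin n) : Set (ℝ × ℝ) :=
  {x | ∃ t : ℝ, 0 < t ∧ x = G.pos (Sum.inl i) + t • l}

/-- The number of intersections of an edge with the gauge rays starting at the boundary sources
(a ray and an edge are not parallel, so that they have at most one common point). -/
def intEdge (G : PBDTPGraph n V E) (l : ℝ × ℝ) (e : E) : ℕ :=
  {i | G.IsSource i ∧
    (G.gaugeRay l i ∩ segment ℝ (G.pos (G.src e)) (G.pos (G.tgt e))).Nonempty}.ncard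

/-- The intersection number of a sequence of edges. -/
def intPath (G : PBDTPGraph n V E) (l : ℝ × ℝ) (P : List E) : ℕ := (P.map (G.intEdge l)).sum

/-- The sign `(-1)^(wind(P) + int(P))`. -/
def pathSign (G : PBDTPGraph n V E) (l : ℝ × ℝ) (P : List E) : ℝ :=
  (-1 : ℝ) ^ (G.wind l P + (G.intPath l P : ℤ))

/-- The weight of a sequence of edges, counted with multiplicities. -/
def pathWeight (w : E → ℝ) (P : List E) : ℝ := (P.map w).prod

/-- `P` is a directed walk (as a list of edges) whose first edge is `e` and which ends at `b_j`. -/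
def IsWalk (G : PBDTPGraph n V E) (e : E) (j : Fin n) (P : List E) : Prop :=
  P.head? = some e ∧ P.IsChain (fun f g => G.tgt f = G.src g) ∧
    ∃ f, P.getLast? = some f ∧ G.tgt f = Sum.inl j

/-- The exponent of the weight monomial of a sequence of edges. -/
def pathExponent (P : List E) : E →₀ ℕ := (P.map (fun e => Finsupp.single e 1)).sum

theorem finite_pathExponent (m : E →₀ ℕ) : {P : List E | pathExponent P = m}.Finite := by
  refine (List.finite_length_eq E (m.sum fun _ k => k)).subset ?_
  rintro P rfl
  change P.length = _
  induction P with
  | nil => simp [pathExponent]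
  | cons a P ih =>
    have h : pathExponent (a :: P) = Finsupp.single a 1 + pathExponent P := by
      simp [pathExponent]
    rw [h, Finsupp.sum_add_index' (fun _ => rfl) (fun _ _ _ => rfl), ← ih]
    simp [add_comm]

theorem finite_walks (G : PBDTPGraph n V E) (e : E) (j : Fin n) (m : E →₀ ℕ) :
    {P : List E | G.IsWalk e j P ∧ pathExponent P = m}.Finite :=
  (finite_pathExponent m).subset fun _ h => h.2

/-- The `j`-th component of the edge vector at `e`: the sum over all directed walks `P` from `e`
to `b_j` of `(-1)^(wind(P) + int(P)) w(P)`, as a formal power series in the edge weights. -/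
def edgeVector (G : PBDTPGraph n V E) (l : ℝ × ℝ) (e : E) (j : Fin n) : MvPowerSeries E ℝ :=
  fun m => ∑ P ∈ (G.finite_walks e j m).toFinset, G.pathSign l P

/-- `x` is the value, at the weights `w`, of the rational function represented by the power
series `S`. -/
def IsRationalValue (S : MvPowerSeries E ℝ) (w : E → ℝ) (x : ℝ) : Prop :=
  ∃ p q : MvPolynomial E ℝ, (q : MvPowerSeries E ℝ) * S = p ∧
    MvPolynomial.eval w q ≠ 0 ∧ x = MvPolynomial.eval w p / MvPolynomial.eval w q

/-- The number of edges of `F` that arrive at `x`. -/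
def inCount (G : PBDTPGraph n V E) (F : Finset E) (x : Fin n ⊕ V) : ℕ :=
  {f | f ∈ F ∧ G.tgt f = x}.ncard

/-- The number of edges of `F` that leave from `x`. -/
def outCount (G : PBDTPGraph n V E) (F : Finset E) (x : Fin n ⊕ V) : ℕ :=
  {f | f ∈ F ∧ G.src f = x}.ncard

/-- Conservative flows. -/
def IsConservativeFlow (G : PBDTPGraph n V E) (C : Finset E) : Prop :=
  (∀ v, G.inCount C (Sum.inr v) = G.outCount C (Sum.inr v)) ∧
  ∀ f ∈ C, ∀ i, G.src f ≠ Sum.inl i ∧ G.tgt f ≠ Sum.inl i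

/-- Edge flows starting at `e` and ending at `b_j`: the flow contains an edge ending at `b_j`, and
apart from this edge and possibly `e` no edge incident to the boundary. -/
def IsEdgeFlow (G : PBDTPGraph n V E) (e : E) (j : Fin n) (F : Finset E) : Prop :=
  e ∈ F ∧
  (∀ v, Sum.inr v ≠ G.src e → G.inCount F (Sum.inr v) = G.outCount F (Sum.inr v)) ∧
  G.inCount F (G.src e) + 1 = G.outCount F (G.src e) ∧
  (∃ f ∈ F, G.tgt f = Sum.inl j) ∧
  ∀ f ∈ F, ∀ i, (G.src f = Sum.inl i → f = e) ∧ (G.tgt f = Sum.inl i → i = j)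

/-- `P` is the edge loop-erased walk of the edge flow `F`: a walk from `e` to `b_j` without repeated
edges such that `F` is the union of `P` and a conservative flow without common edges with `P`. -/
def IsFlowWalk (G : PBDTPGraph n V E) (e : E) (j : Fin n) (F : Finset E) (P : List E) : Prop :=
  G.IsWalk e j P ∧ P.Nodup ∧ ∃ C : Finset E, G.IsConservativeFlow C ∧
    (∀ f ∈ C, f ∉ P) ∧ ∀ f, f ∈ F ↔ f ∈ P ∨ f ∈ C

open scoped Classical in
/-- The edge loop-erased walk of an edge flow. -/
def flowWalk (G : PBDTPGraph n V E) (e : E) (j : Fin n) (F : Finset E) : List E :=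
  if h : ∃ P, G.IsFlowWalk e j F P then h.choose else []

/-- The sign `(-1)^(wind(F) + int(F))` of an edge flow: the one of its edge loop-erased walk. -/
def flowSign (G : PBDTPGraph n V E) (l : ℝ × ℝ) (e : E) (j : Fin n) (F : Finset E) : ℝ :=
  G.pathSign l (G.flowWalk e j F)

/-- The weight of a collection of distinct edges, as a monomial in the edge weights. -/
def flowMonomial (F : Finset E) : MvPolynomial E ℝ := ∏ f ∈ F, MvPolynomial.X f

open scoped Classical in
/-- The sum of the weights of all conservative flows. -/
def conservativeSum (G : PBDTPGraph n V E) : MvPolynomial E ℝ :=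
  ∑ C : Finset E with G.IsConservativeFlow C, flowMonomial C

open scoped Classical in
/-- The signed sum of the weights of all edge flows from `e` to `b_j`. -/
def edgeFlowSum (G : PBDTPGraph n V E) (l : ℝ × ℝ) (e : E) (j : Fin n) : MvPolynomial E ℝ :=
  ∑ F : Finset E with G.IsEdgeFlow e j F, MvPolynomial.C (G.flowSign l e j F) * flowMonomial F

end PBDTPGraph

end

noncomputable section

/-! ### Simple polygons -/

/-! Let D be the sum over conservative flows and N_e the signed sum over edge flows from e to b_j;
the point is D·E_e = N_e. Splitting off the first edge of a walk gives E_e = σ_e x_e ([e ends at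
b_j] + Σ_f τ_ef E_f), where f runs over the edges leaving the end of e, σ_e = (-1)^int(e) and τ_ef =
(-1)^wind(e,f) (`edgeVector_eq`). The N_e satisfy the same system with D·[e ends at b_j] as
inhomogeneous term (`edgeFlowSum_eq`). So D·E_e - N_e solves the homogeneous system, and the factor
x_e forces its coefficients to vanish degree by degree (`eq_zero_of_recursion`).

In the system for N_e, edge flows from e correspond to edge flows from a successor f that avoid e.
The flows F from f that contain e have to cancel (`flowSign_cancel`): at the end v of e, F has one
arriving edge e and two leaving edges f, g, and it is an edge flow from both. One of the two
loop-erased walks, say the one from f, comes back to v through e and then continues as the walk from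
g. The two contributions thus differ by the sign of a closed walk without repeated edges, which is
-1 (`pathSign_closed`).

That sign is geometric. By perfectness such a closed walk is a simple polygon. It crosses the gauge
rays an even number of times, since each ray cuts the open disk in two along a line. The parity of
its winding is that of the number of times the tangent passes through the direction `l`, which is
odd: a mod 2 form of Hopf's Umlaufsatz (`parity_polygon`). The latter is proved by counting mod 2,
over all pairs of sides, the end points of one side that lie below or above the other. -/

/-- The ordinate at `x` of the line through `A` and `B`. -/
def lineAt (A B : ℝ × ℝ) (x : ℝ) : ℝ := A.2 + (B.2 - A.2) / (B.1 - A.1) * (x - A.1)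

/-- `x` is strictly between the abscissas of `A` and `B`. -/
def XBetween (A B : ℝ × ℝ) (x : ℝ) : Prop := (A.1 < x ∧ x < B.1) ∨ (B.1 < x ∧ x < A.1)

/-- `P` is strictly below the segment with end points `A` and `B`. -/
def IsBelow (P A B : ℝ × ℝ) : Prop := XBetween A B P.1 ∧ P.2 < lineAt A B P.1

/-- `P` is strictly above the segment with end points `A` and `B`. -/
def IsAbove (P A B : ℝ × ℝ) : Prop := XBetween A B P.1 ∧ lineAt A B P.1 < P.2

/-- The shortest rotation from `B - A` to `C - B` passes through the vertical upward direction. -/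
def TurnsUp (A B C : ℝ × ℝ) : Prop :=
  (A.1 < B.1 ∧ C.1 < B.1 ∧ 0 < planeCross (B - A) (C - B)) ∨
    (B.1 < A.1 ∧ B.1 < C.1 ∧ planeCross (B - A) (C - B) < 0)

open scoped Classical in
/-- The indicator of a proposition modulo two. -/
def parityInd (p : Prop) : ZMod 2 := if p then 1 else 0

theorem parityInd_true {p : Prop} (h : p) : parityInd p = 1 := by simp [parityInd, h]

theorem parityInd_false {p : Prop} (h : ¬p) : parityInd p = 0 := by simp [parityInd, h]

theorem lineAt_left (A B : ℝ × ℝ) : lineAt A B A.1 = A.2 := by simp [lineAt]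

theorem lineAt_right {A B : ℝ × ℝ} (h : A.1 ≠ B.1) : lineAt A B B.1 = B.2 := by
  have : B.1 - A.1 ≠ 0 := sub_ne_zero.2 h.symm
  unfold lineAt; field_simp; ring

theorem lineAt_swap {A B : ℝ × ℝ} (h : A.1 ≠ B.1) (x : ℝ) : lineAt A B x = lineAt B A x := by
  have h1 : B.1 - A.1 ≠ 0 := sub_ne_zero.2 h.symm
  have h2 : A.1 - B.1 ≠ 0 := sub_ne_zero.2 h
  unfold lineAt; field_simp; ring

theorem xBetween_swap (A B : ℝ × ℝ) (x : ℝ) : XBetween A B x ↔ XBetween B A x := or_comm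

theorem isBelow_swap {A B : ℝ × ℝ} (h : A.1 ≠ B.1) (P : ℝ × ℝ) :
    IsBelow P A B ↔ IsBelow P B A := by
  unfold IsBelow; rw [xBetween_swap, lineAt_swap h]

theorem isAbove_swap {A B : ℝ × ℝ} (h : A.1 ≠ B.1) (P : ℝ × ℝ) :
    IsAbove P A B ↔ IsAbove P B A := by
  unfold IsAbove; rw [xBetween_swap, lineAt_swap h]

theorem lineAt_mem_segment {A B : ℝ × ℝ} (h : A.1 < B.1) {x : ℝ} (h1 : A.1 ≤ x) (h2 : x ≤ B.1) :
    (x, lineAt A B x) ∈ segment ℝ A B := by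
  have h0 : 0 < B.1 - A.1 := sub_pos.2 h
  refine ⟨(B.1 - x) / (B.1 - A.1), (x - A.1) / (B.1 - A.1), ?_, ?_, ?_, ?_⟩
  · exact div_nonneg (sub_nonneg.2 h2) h0.le
  · exact div_nonneg (sub_nonneg.2 h1) h0.le
  · field_simp; ring
  · ext
    · simp; field_simp; ring
    · simp [lineAt]; field_simp; ring

/-- If the vertical order changed over the common abscissas, the intermediate value theorem would
give a common point. -/
theorem lineAt_lt_iff_of_disjoint {A B C D : ℝ × ℝ} (hAB : A.1 < B.1) (hCD : C.1 < D.1)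
    (hd : Disjoint (segment ℝ A B) (segment ℝ C D)) {x y : ℝ}
    (hx : A.1 ≤ x ∧ x ≤ B.1 ∧ C.1 ≤ x ∧ x ≤ D.1) (hy : A.1 ≤ y ∧ y ≤ B.1 ∧ C.1 ≤ y ∧ y ≤ D.1) :
    lineAt A B x < lineAt C D x ↔ lineAt A B y < lineAt C D y := by
  have hne : ∀ z, A.1 ≤ z ∧ z ≤ B.1 ∧ C.1 ≤ z ∧ z ≤ D.1 → lineAt C D z - lineAt A B z ≠ 0 := by
    rintro z ⟨h1, h2, h3, h4⟩ h0
    have e := sub_eq_zero.1 h0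
    exact Set.disjoint_left.1 hd (lineAt_mem_segment hAB h1 h2)
      (e ▸ lineAt_mem_segment hCD h3 h4)
  have hc : Continuous fun z => lineAt C D z - lineAt A B z := by unfold lineAt; fun_prop
  have key : ∀ x y, (A.1 ≤ x ∧ x ≤ B.1 ∧ C.1 ≤ x ∧ x ≤ D.1) →
      (A.1 ≤ y ∧ y ≤ B.1 ∧ C.1 ≤ y ∧ y ≤ D.1) →
      lineAt A B x < lineAt C D x → lineAt A B y < lineAt C D y := by
    intro x y hx hy hlt
    by_contra hcon
    have hm : (0 : ℝ) ∈ Set.uIcc (lineAt C D x - lineAt A B x) (lineAt C D y - lineAt A B y) :=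
      Set.mem_uIcc.2 (Or.inr ⟨by linarith, by linarith⟩)
    obtain ⟨z, hz, h0⟩ := intermediate_value_uIcc (f := fun z => lineAt C D z - lineAt A B z)
      hc.continuousOn hm
    refine hne z ?_ h0
    rcases Set.mem_uIcc.1 hz with h | h
    · exact ⟨hx.1.trans h.1, h.2.trans hy.2.1, hx.2.2.1.trans h.1, h.2.trans hy.2.2.2⟩
    · exact ⟨hy.1.trans h.1, h.2.trans hx.2.1, hy.2.2.1.trans h.1, h.2.trans hx.2.2.2⟩
  exact ⟨key x y hx hy, key y x hy hx⟩

theorem parityInd_congr {p q : Prop} (h : p ↔ q) : parityInd p = parityInd q := by rw [propext h]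

theorem parityInd_add_self {p q : Prop} (h : p ↔ q) : parityInd p + parityInd q = 0 := by
  rw [propext h]; exact CharTwo.add_self_eq_zero _

/-- If the ranges of abscissas overlap, each of the two ends of the overlap is the abscissa of
exactly one of the four points, and that point is counted exactly when AB lies below CD there. The
vertical order is constant on the overlap, so the count is 0 or 2. -/
theorem cell_of_lt {A B C D : ℝ × ℝ} (hAB : A.1 < B.1) (hCD : C.1 < D.1)
    (hAC : A.1 ≠ C.1) (hAD : A.1 ≠ D.1) (hBC : B.1 ≠ C.1) (hBD : B.1 ≠ D.1)
    (hd : Disjoint (segment ℝ A B) (segment ℝ C D)) :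
    parityInd (IsBelow A C D) + parityInd (IsBelow B C D) + parityInd (IsAbove C A B) +
      parityInd (IsAbove D A B) = 0 := by
  have hA : IsBelow A C D ↔ (C.1 < A.1 ∧ A.1 < D.1) ∧ lineAt A B A.1 < lineAt C D A.1 := by
    rw [lineAt_left]; unfold IsBelow XBetween
    exact and_congr_left' (or_iff_left fun h => by linarith [h.1, h.2])
  have hB : IsBelow B C D ↔ (C.1 < B.1 ∧ B.1 < D.1) ∧ lineAt A B B.1 < lineAt C D B.1 := by
    rw [lineAt_right hAB.ne]; unfold IsBelow XBetween
    exact and_congr_left' (or_iff_left fun h => by linarith [h.1, h.2])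
  have hC : IsAbove C A B ↔ (A.1 < C.1 ∧ C.1 < B.1) ∧ lineAt A B C.1 < lineAt C D C.1 := by
    rw [lineAt_left]; unfold IsAbove XBetween
    exact and_congr_left' (or_iff_left fun h => by linarith [h.1, h.2])
  have hD : IsAbove D A B ↔ (A.1 < D.1 ∧ D.1 < B.1) ∧ lineAt A B D.1 < lineAt C D D.1 := by
    rw [lineAt_right hCD.ne]; unfold IsAbove XBetween
    exact and_congr_left' (or_iff_left fun h => by linarith [h.1, h.2])
  have key := fun {x y : ℝ} => lineAt_lt_iff_of_disjoint hAB hCD hd (x := x) (y := y)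
  rw [parityInd_congr hA, parityInd_congr hB, parityInd_congr hC, parityInd_congr hD]
  rcases lt_or_gt_of_ne hAC with h1 | h1 <;> rcases lt_or_gt_of_ne hBD with h2 | h2
  · rw [parityInd_false (p := (C.1 < A.1 ∧ _) ∧ _) (fun h => by linarith [h.1.1]),
      parityInd_false (p := (_ ∧ D.1 < B.1) ∧ _) (fun h => by linarith [h.1.2]), zero_add, add_zero]
    rcases lt_or_gt_of_ne hBC with h3 | h3
    · rw [parityInd_false (fun h => by linarith [h.1.1]),
        parityInd_false (fun h => by linarith [h.1.2]), add_zero]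
    · refine parityInd_add_self ?_
      rw [and_iff_right ⟨h3, h2⟩, and_iff_right ⟨h1, h3⟩]
      exact key ⟨hAB.le, le_rfl, h3.le, h2.le⟩ ⟨h1.le, h3.le, le_rfl, hCD.le⟩
  · rw [parityInd_false (p := (C.1 < A.1 ∧ _) ∧ _) (fun h => by linarith [h.1.1]),
      parityInd_false (p := (_ ∧ B.1 < D.1) ∧ _) (fun h => by linarith [h.1.2]), zero_add, zero_add]
    refine parityInd_add_self ?_
    rw [and_iff_right ⟨h1, by linarith⟩, and_iff_right ⟨by linarith, h2⟩]
    exact key ⟨h1.le, by linarith, le_rfl, hCD.le⟩ ⟨by linarith, h2.le, hCD.le, le_rfl⟩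
  · rw [parityInd_false (p := (A.1 < C.1 ∧ _) ∧ _) (fun h => by linarith [h.1.1]),
      parityInd_false (p := (_ ∧ D.1 < B.1) ∧ _) (fun h => by linarith [h.1.2]), add_zero, add_zero]
    refine parityInd_add_self ?_
    rw [and_iff_right ⟨h1, by linarith⟩, and_iff_right ⟨by linarith, h2⟩]
    exact key ⟨le_rfl, hAB.le, h1.le, by linarith⟩ ⟨hAB.le, le_rfl, by linarith, h2.le⟩
  · rw [parityInd_false (p := (A.1 < C.1 ∧ _) ∧ _) (fun h => by linarith [h.1.1]),
      parityInd_false (p := (_ ∧ B.1 < D.1) ∧ _) (fun h => by linarith [h.1.2]), add_zero, add_zero]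
    rcases lt_or_gt_of_ne hAD with h3 | h3
    · refine parityInd_add_self ?_
      rw [and_iff_right ⟨h1, h3⟩, and_iff_right ⟨h3, h2⟩]
      exact key ⟨le_rfl, hAB.le, h1.le, h3.le⟩ ⟨h3.le, h2.le, hCD.le, le_rfl⟩
    · rw [parityInd_false (fun h => by linarith [h.1.2]),
        parityInd_false (fun h => by linarith [h.1.1]), add_zero]

/-- Two disjoint segments in general position: the number of end points of the first that are below
the second plus the number of end points of the second above the first is even. -/
theorem parity_cell {A B C D : ℝ × ℝ} (hAB : A.1 ≠ B.1) (hCD : C.1 ≠ D.1)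
    (hAC : A.1 ≠ C.1) (hAD : A.1 ≠ D.1) (hBC : B.1 ≠ C.1) (hBD : B.1 ≠ D.1)
    (hd : Disjoint (segment ℝ A B) (segment ℝ C D)) :
    parityInd (IsBelow A C D) + parityInd (IsBelow B C D) + parityInd (IsAbove C A B) +
      parityInd (IsAbove D A B) = 0 := by
  rcases lt_or_gt_of_ne hAB with h1 | h1 <;> rcases lt_or_gt_of_ne hCD with h2 | h2
  · exact cell_of_lt h1 h2 hAC hAD hBC hBD hd
  · rw [parityInd_congr (isBelow_swap hCD A), parityInd_congr (isBelow_swap hCD B)]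
    have := cell_of_lt h1 h2 hAD hAC hBD hBC (by rwa [segment_symm ℝ D C])
    linear_combination this
  · rw [parityInd_congr (isAbove_swap hAB C), parityInd_congr (isAbove_swap hAB D)]
    have := cell_of_lt h1 h2 hBC hBD hAC hAD (by rwa [segment_symm ℝ B A])
    linear_combination this
  · rw [parityInd_congr (isAbove_swap hAB C), parityInd_congr (isAbove_swap hAB D),
      parityInd_congr (isBelow_swap hCD A), parityInd_congr (isBelow_swap hCD B)]
    have := cell_of_lt h1 h2 hBD hBC hAD hAC (by rwa [segment_symm ℝ D C, segment_symm ℝ B A])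
    linear_combination this

theorem lt_lineAt_iff {A B P : ℝ × ℝ} (h : A.1 < B.1) :
    P.2 < lineAt A B P.1 ↔ planeCross (B - A) (P - A) < 0 := by
  have h0 : 0 < B.1 - A.1 := sub_pos.2 h
  have e : planeCross (B - A) (P - A) = (B.1 - A.1) * (P.2 - lineAt A B P.1) := by
    simp only [planeCross, lineAt, Prod.fst_sub, Prod.snd_sub]; field_simp; ring
  rw [e, mul_neg_iff]
  constructor
  · intro h1; exact Or.inl ⟨h0, by linarith⟩
  · rintro (h1 | h1) <;> linarith [h1.1, h1.2]

theorem lineAt_lt_iff {A B P : ℝ × ℝ} (h : A.1 < B.1) :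
    lineAt A B P.1 < P.2 ↔ 0 < planeCross (B - A) (P - A) := by
  have h0 : 0 < B.1 - A.1 := sub_pos.2 h
  have e : planeCross (B - A) (P - A) = (B.1 - A.1) * (P.2 - lineAt A B P.1) := by
    simp only [planeCross, lineAt, Prod.fst_sub, Prod.snd_sub]; field_simp; ring
  rw [e, mul_pos_iff]
  constructor
  · intro h1; exact Or.inl ⟨h0, by linarith⟩
  · rintro (h1 | h1) <;> linarith [h1.1, h1.2]

/-- Nothing is counted unless B is a fold, that is, A and C lie on the same side of the vertical
through B. At a fold only the one of A, C nearer to that vertical can count, and it counts exactly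
when BA is below BC, which decides whether the turn is through the upward or the downward direction.
-/
theorem parity_corner {A B C : ℝ × ℝ} (hAB : A.1 ≠ B.1) (hBC : B.1 ≠ C.1) (hAC : A.1 ≠ C.1) :
    parityInd (IsBelow A B C) + parityInd (IsAbove C A B) = parityInd (TurnsUp A B C) := by
  have e1 : planeCross (B - A) (C - B) = planeCross (B - A) (C - A) := by
    simp only [planeCross, Prod.fst_sub, Prod.snd_sub]; ring
  have e2 : planeCross (B - A) (C - B) = - planeCross (A - B) (C - B) := by
    simp only [planeCross, Prod.fst_sub, Prod.snd_sub]; ring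
  have e3 : planeCross (B - A) (C - B) = planeCross (C - B) (A - B) := by
    simp only [planeCross, Prod.fst_sub, Prod.snd_sub]; ring
  have e4 : planeCross (B - A) (C - B) = - planeCross (B - C) (A - C) := by
    simp only [planeCross, Prod.fst_sub, Prod.snd_sub]; ring
  rcases lt_or_gt_of_ne hAB with h1 | h1 <;> rcases lt_or_gt_of_ne hBC with h2 | h2
  · rw [parityInd_false, parityInd_false, parityInd_false, add_zero]
    · rintro (h | h) <;> linarith [h.1, h.2.1]
    · rintro ⟨h | h, -⟩ <;> linarith [h.1, h.2]
    · rintro ⟨h | h, -⟩ <;> linarith [h.1, h.2]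
  · rcases lt_or_gt_of_ne hAC with h3 | h3
    · rw [parityInd_false (p := IsBelow A B C), zero_add]
      · refine parityInd_congr ?_
        unfold IsAbove TurnsUp
        rw [lineAt_lt_iff h1, e1, and_iff_right (show XBetween _ _ _ from Or.inl ⟨h3, h2⟩)]
        constructor
        · intro h; exact Or.inl ⟨h1, h2, h⟩
        · rintro (h | h)
          · exact h.2.2
          · linarith [h.1]
      · rintro ⟨h | h, -⟩ <;> linarith [h.1, h.2]
    · rw [parityInd_false (p := IsAbove C A B), add_zero]
      · refine parityInd_congr ?_
        rw [isBelow_swap hBC]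
        unfold IsBelow TurnsUp
        rw [lt_lineAt_iff h2, e4, and_iff_right (show XBetween _ _ _ from Or.inl ⟨h3, h1⟩)]
        constructor
        · intro h; exact Or.inl ⟨h1, h2, by linarith⟩
        · rintro (h | h)
          · linarith [h.2.2]
          · linarith [h.1]
      · rintro ⟨h | h, -⟩ <;> linarith [h.1, h.2]
  · rcases lt_or_gt_of_ne hAC with h3 | h3
    · rw [parityInd_false (p := IsAbove C A B), add_zero]
      · refine parityInd_congr ?_
        unfold IsBelow TurnsUp
        rw [lt_lineAt_iff h2, e3, and_iff_right (show XBetween _ _ _ from Or.inl ⟨h1, h3⟩)]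
        constructor
        · intro h; exact Or.inr ⟨h1, h2, by linarith⟩
        · rintro (h | h)
          · linarith [h.1]
          · linarith [h.2.2]
      · rintro ⟨h | h, -⟩ <;> linarith [h.1, h.2]
    · rw [parityInd_false (p := IsBelow A B C), zero_add]
      · refine parityInd_congr ?_
        rw [isAbove_swap hAB]
        unfold IsAbove TurnsUp
        rw [lineAt_lt_iff h1, e2, and_iff_right (show XBetween _ _ _ from Or.inl ⟨h2, h3⟩)]
        constructor
        · intro h; exact Or.inr ⟨h1, h2, by linarith⟩
        · rintro (h | h)
          · linarith [h.1]
          · linarith [h.2.2]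
      · rintro ⟨h | h, -⟩ <;> linarith [h.1, h.2]
  · rw [parityInd_false, parityInd_false, parityInd_false, add_zero]
    · rintro (h | h) <;> linarith [h.1, h.2.1]
    · rintro ⟨h | h, -⟩ <;> linarith [h.1, h.2]
    · rintro ⟨h | h, -⟩ <;> linarith [h.1, h.2]

/-- At a fold, reversing the direction of travel exchanges upward and downward turns. This is the
source of the odd unit in the final count. -/
theorem parity_corner_leftmost {A B C : ℝ × ℝ} (hA : B.1 < A.1) (hC : B.1 < C.1)
    (hAC : A.1 ≠ C.1) (h0 : planeCross (B - A) (C - B) ≠ 0) :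
    parityInd (IsBelow A C B) + parityInd (IsAbove C B A) = 1 + parityInd (TurnsUp C B A) := by
  rw [parityInd_congr (isBelow_swap hC.ne' A), parityInd_congr (isAbove_swap hA.ne C),
    parity_corner hA.ne' hC.ne hAC]
  have e : planeCross (B - C) (A - B) = - planeCross (B - A) (C - B) := by
    simp only [planeCross, Prod.fst_sub, Prod.snd_sub]; ring
  rcases lt_or_gt_of_ne h0 with h | h
  · rw [parityInd_true (p := TurnsUp A B C) (Or.inr ⟨hA, hC, h⟩), parityInd_false, add_zero]
    rintro (h1 | h1) <;> linarith [h1.1, h1.2.2]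
  · rw [parityInd_true (p := TurnsUp C B A) (Or.inr ⟨hC, hA, by linarith⟩), parityInd_false]
    · decide
    · rintro (h1 | h1) <;> linarith [h1.1, h1.2.2]

theorem sum_add_succ_char_two (f : ℕ → ZMod 2) (a b : ℕ) (h : a ≤ b) :
    ∑ i ∈ Finset.Ico a b, (f i + f (i + 1)) = f a + f b := by
  have h1 : ∀ i, f i + f (i + 1) = f (i + 1) - f i := fun i => by
    rw [CharTwo.sub_eq_add, add_comm]
  simp_rw [h1]
  rw [Finset.sum_Ico_sub f h, CharTwo.sub_eq_add, add_comm]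

/-- The incidences between sides and end points are summed over all pairs of sides i < j in two
ways. Telescoping along the polygon gives 0. Pair by pair, sides without a common vertex give 0,
consecutive ones the turn at their common vertex, and the first and last side the turn at the
leftmost vertex plus 1. -/
theorem parity_polygon_of_leftmost (m : ℕ) (hm : 3 ≤ m) (v : ℕ → ℝ × ℝ)
    (hv : ∀ i, v (i + m) = v i)
    (hx : ∀ i j, i < j → j < m → (v i).1 ≠ (v j).1)
    (hleft : ∀ i, (v 0).1 ≤ (v i).1)
    (hadj : ∀ i, planeCross (v (i + 1) - v i) (v (i + 2) - v (i + 1)) = 0 →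
      ¬ ((v i).1 < (v (i + 1)).1 ↔ (v (i + 2)).1 < (v (i + 1)).1))
    (hdisj : ∀ i j, i + 1 < j → j < m → (i = 0 → j + 1 < m) →
      Disjoint (segment ℝ (v i) (v (i + 1))) (segment ℝ (v j) (v (j + 1)))) :
    ∑ i ∈ Finset.range m, parityInd (TurnsUp (v i) (v (i + 1)) (v (i + 2))) = 1 := by
  have hvm : v m = v 0 := by simpa using hv 0
  have hx' : ∀ i j, i < j → j ≤ m → (0 < i ∨ j < m) → (v i).1 ≠ (v j).1 := by
    intro i j hij hj h
    rcases hj.lt_or_eq with hj | rfl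
    · exact hx i j hij hj
    · rw [hvm]; exact (hx 0 i (by omega) hij).symm
  set A : ℕ → ℕ → ZMod 2 := fun i j => parityInd (IsBelow (v i) (v j) (v (j + 1))) with hA
  set B : ℕ → ℕ → ZMod 2 := fun i j => parityInd (IsAbove (v j) (v i) (v (i + 1))) with hB
  set W : ℕ → ZMod 2 := fun i => parityInd (TurnsUp (v i) (v (i + 1)) (v (i + 2))) with hW
  set K : ℕ → ℕ → ZMod 2 := fun i j => (A i j + A (i + 1) j) + (B i j + B i (j + 1)) with hK
  have hAd : ∀ j, A j j = 0 := fun j => parityInd_false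
    (by rintro ⟨h | h, -⟩ <;> linarith [h.1, h.2])
  have hBd : ∀ j, B j (j + 1) = 0 := fun j => parityInd_false
    (by rintro ⟨h | h, -⟩ <;> linarith [h.1, h.2])
  have hA0 : ∀ j, A 0 j = 0 := fun j => parityInd_false
    (by rintro ⟨h | h, -⟩ <;> linarith [h.1, h.2, hleft j, hleft (j + 1)])
  have hBm : ∀ j, B j m = 0 := fun j => parityInd_false
    (by rw [hvm]; rintro ⟨h | h, -⟩ <;> linarith [h.1, h.2, hleft j, hleft (j + 1)])
  -- Each telescoped sum leaves two boundary terms, both zero: one because a vertex is compared with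
  -- a side of which it is an end point, the other because the leftmost vertex is strictly between
  -- no two abscissas.
  have hsum : ∑ j ∈ Finset.range m, ∑ i ∈ Finset.range j, K i j = 0 := by
    simp_rw [hK, Finset.sum_add_distrib (f := fun i => A i _ + A (i + 1) _)]
    rw [Finset.sum_add_distrib]
    have h1 : ∑ j ∈ Finset.range m, ∑ i ∈ Finset.range j, (A i j + A (i + 1) j) = 0 := by
      refine Finset.sum_eq_zero fun j _ => ?_
      have := sum_add_succ_char_two (fun i => A i j) 0 j (Nat.zero_le j)
      rw [Nat.Ico_zero_eq_range] at this
      rw [this, hA0, hAd, add_zero]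
    have h2 : ∑ j ∈ Finset.range m, ∑ i ∈ Finset.range j, (B i j + B i (j + 1)) = 0 := by
      have : ∑ j ∈ Finset.range m, ∑ i ∈ Finset.range j, (B i j + B i (j + 1)) =
          ∑ i ∈ Finset.range m, ∑ j ∈ Finset.Ico (i + 1) m, (B i j + B i (j + 1)) := by
        refine Finset.sum_comm' fun j i => ?_
        simp only [Finset.mem_range, Finset.mem_Ico]; omega
      rw [this]
      refine Finset.sum_eq_zero fun i hi => ?_
      rw [sum_add_succ_char_two (fun j => B i j) (i + 1) m (by simpa using hi), hBd, hBm, add_zero]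
    rw [h1, h2, add_zero]
  have hKadj : ∀ i, i + 1 < m → K i (i + 1) = W i := by
    intro i hi
    have := parity_corner (A := v i) (B := v (i + 1)) (C := v (i + 2))
      (hx' _ _ (by omega) (by omega) (by omega)) (hx' _ _ (by omega) (by omega) (by omega))
      (hx' _ _ (by omega) (by omega) (by omega))
    simp only [hK, hAd, hBd, add_zero, zero_add]
    exact this
  -- The first and last sides meet at vertex 0, but the order i < j reads this corner against the
  -- direction of travel.
  have hKlast : K 0 (m - 1) = 1 + W (m - 1) := by
    have hm1 : m - 1 + 1 = m := by omega
    have hm2 : m - 1 + 2 = 1 + m := by omega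
    have h1 : (v 0).1 < (v 1).1 := (hleft 1).lt_of_ne (hx 0 1 (by omega) (by omega))
    have h2 : (v 0).1 < (v (m - 1)).1 := (hleft _).lt_of_ne (hx 0 _ (by omega) (by omega))
    have := parity_corner_leftmost h1 h2 (hx 1 (m - 1) (by omega) (by omega)) (by
      intro h0
      have h3 := hadj (m - 1)
      rw [hm1, hm2, hv 1, hvm] at h3
      refine h3 ?_ (iff_of_false (by linarith) (by linarith))
      rw [← neg_eq_zero, ← h0]
      simp only [planeCross, Prod.fst_sub, Prod.snd_sub]; ring)
    have h4 := hA0 (m - 1)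
    have h5 : B 0 (m - 1 + 1) = 0 := by rw [hm1]; exact hBm 0
    simp only [hK, h4, h5, add_zero, zero_add]
    simp only [hA, hB, hW, hm1, hm2, hv 1, hvm, zero_add]
    exact this
  have hKrest : ∀ i j, i + 1 < j → j < m → (i = 0 → j + 1 < m) → K i j = 0 := by
    intro i j hij hj h0
    have := parity_cell (hx' i (i + 1) (by omega) (by omega) (by omega))
      (hx' j (j + 1) (by omega) (by omega) (by omega))
      (hx' i j (by omega) (by omega) (by omega)) (hx' i (j + 1) (by omega) (by omega) (by omega))
      (hx' (i + 1) j (by omega) (by omega) (by omega))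
      (hx' (i + 1) (j + 1) (by omega) (by omega) (by omega)) (hdisj i j hij hj h0)
    simp only [hK, hA, hB, ← this]; ring
  obtain ⟨r, rfl⟩ : ∃ r, m = r + 3 := ⟨m - 3, by omega⟩
  have hcol : ∀ j ∈ Finset.range (r + 1), ∑ i ∈ Finset.range (j + 1), K i (j + 1) = W j := by
    intro j hj
    have hj' := Finset.mem_range.1 hj
    rw [Finset.sum_range_succ, Finset.sum_eq_zero, zero_add, hKadj j (by omega)]
    intro i hi
    have hi' := Finset.mem_range.1 hi
    exact hKrest i (j + 1) (by omega) (by omega) (by omega)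
  have hlast : ∑ i ∈ Finset.range (r + 2), K i (r + 2) = 1 + W (r + 2) + W (r + 1) := by
    rw [Finset.sum_range_succ, Finset.sum_range_succ', Finset.sum_eq_zero, zero_add,
      hKadj (r + 1) (by omega)]
    · congr 1
    intro i hi
    have hi' := Finset.mem_range.1 hi
    exact hKrest (i + 1) (r + 2) (by omega) (by omega) (by omega)
  rw [Finset.sum_range_succ, hlast, Finset.sum_range_succ', Finset.sum_range_zero, add_zero,
    Finset.sum_congr rfl hcol] at hsum
  rw [Finset.sum_range_succ, Finset.sum_range_succ]
  have h2 : (1 : ZMod 2) + 1 = 0 := by decide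
  linear_combination hsum + h2 * (-1)

/-! ### Simple polygons with respect to an arbitrary direction -/

/-- The shortest rotation from `u` to `v` passes through the direction `l`. -/
def RotatesThrough (l u v : ℝ × ℝ) : Prop :=
  (0 < planeCross u l ∧ planeCross v l < 0 ∧ 0 < planeCross u v) ∨
    (planeCross u l < 0 ∧ 0 < planeCross v l ∧ planeCross u v < 0)

theorem sum_range_shift_of_periodic (m k : ℕ) (f : ℕ → ZMod 2) (hf : ∀ i, f (i + m) = f i) :
    ∑ i ∈ Finset.range m, f (i + k) = ∑ i ∈ Finset.range m, f i := by
  induction k with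
  | zero => simp
  | succ k ih =>
    rw [← ih]
    have h1 := Finset.sum_range_succ (fun i => f (i + k)) m
    have h2 := Finset.sum_range_succ' (fun i => f (i + k)) m
    have h3 : f (m + k) = f (0 + k) := by rw [add_comm m k, hf, zero_add]
    rw [h1, h3] at h2
    simpa [add_assoc, add_comm 1 k] using (add_right_cancel h2).symm

-- Rotating `l` slightly keeps the finitely many strict signs and avoids the finitely many
-- directions `p k`. It makes the abscissas of the vertices of a polygon distinct.
open Filter Topology in
theorem exists_generic_direction {ι κ : Type*} [Finite ι] [Finite κ] {l : ℝ × ℝ} (hl : l ≠ 0)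
    (d : ι → ℝ × ℝ) (hd : ∀ i, planeCross (d i) l ≠ 0) (p : κ → ℝ × ℝ) (hp : ∀ k, p k ≠ 0) :
    ∃ l', (∀ i, 0 < planeCross (d i) l' * planeCross (d i) l) ∧ ∀ k, planeCross (p k) l' ≠ 0 := by
  set u : ℝ × ℝ := (-l.2, l.1) with hu
  have hcont : ∀ q : ℝ × ℝ, Continuous fun t : ℝ => planeCross q (l + t • u) := fun q => by
    simp only [planeCross, Prod.fst_add, Prod.snd_add, Prod.smul_fst, Prod.smul_snd, smul_eq_mul]
    fun_prop
  have hadd : ∀ (q : ℝ × ℝ) (t : ℝ),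
      planeCross q (l + t • u) = planeCross q l + t * planeCross q u := fun q t => by
    simp [planeCross]; ring
  have h0 : ∀ q, planeCross q (l + (0 : ℝ) • u) = planeCross q l := fun q => by simp
  have hev1 : ∀ᶠ t : ℝ in 𝓝[≠] 0, ∀ i,
      0 < planeCross (d i) (l + t • u) * planeCross (d i) l := by
    rw [eventually_all]
    intro i
    refine nhdsWithin_le_nhds ?_
    refine ((hcont (d i)).mul continuous_const).continuousAt.eventually (lt_mem_nhds ?_)
    simp only [Pi.mul_apply, h0]; exact mul_self_pos.2 (hd i)
  have hev2 : ∀ᶠ t : ℝ in 𝓝[≠] 0, ∀ k, planeCross (p k) (l + t • u) ≠ 0 := by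
    rw [eventually_all]
    intro k
    by_cases h1 : planeCross (p k) l = 0
    · have h2 : planeCross (p k) u ≠ 0 := by
        intro h2
        have hl2 : 0 < l.1 ^ 2 + l.2 ^ 2 := by
          by_contra hcon
          apply hl
          ext <;> simp <;> nlinarith [sq_nonneg l.1, sq_nonneg l.2]
        simp only [planeCross, hu] at h1 h2
        apply hp k
        ext
        · have : (p k).1 * (l.1 ^ 2 + l.2 ^ 2) = 0 := by linear_combination l.2 * h1 + l.1 * h2
          simpa [hl2.ne'] using this
        · have : (p k).2 * (l.1 ^ 2 + l.2 ^ 2) = 0 := by linear_combination l.2 * h2 - l.1 * h1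
          simpa [hl2.ne'] using this
      filter_upwards [self_mem_nhdsWithin] with t ht
      rw [hadd, h1, zero_add]
      exact mul_ne_zero ht h2
    · refine nhdsWithin_le_nhds ?_
      refine (hcont (p k)).continuousAt.eventually (isOpen_ne.mem_nhds ?_)
      simpa only [Set.mem_ofPred_eq, h0] using h1
  obtain ⟨t, h1, h2⟩ := (hev1.and hev2).exists
  exact ⟨_, h1, h2⟩

/-- The linear change of coordinates with `l` as the vertical direction. -/
def uprightMap (l : ℝ × ℝ) : ℝ × ℝ →ₗ[ℝ] ℝ × ℝ where
  toFun p := (planeCross p l, p.1 * l.1 + p.2 * l.2)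
  map_add' p q := by ext <;> simp [planeCross] <;> ring
  map_smul' c p := by ext <;> simp [planeCross] <;> ring

/-- The factor is positive for `l ≠ 0`, so orientations are preserved, and `l` itself is sent to the
upward vertical. -/
theorem planeCross_uprightMap (l p q : ℝ × ℝ) :
    planeCross (uprightMap l p) (uprightMap l q) = (l.1 ^ 2 + l.2 ^ 2) * planeCross p q := by
  simp only [planeCross, uprightMap, LinearMap.coe_mk, AddHom.coe_mk]; ring

theorem planeCross_sub_left (p q l : ℝ × ℝ) :
    planeCross (p - q) l = planeCross p l - planeCross q l := by
  simp only [planeCross, Prod.fst_sub, Prod.snd_sub]; ring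

/-- The tangent direction of a simple closed polygon passes through a given direction an odd number
of times. -/
theorem parity_polygon (m : ℕ) (hm : 3 ≤ m) (v : ℕ → ℝ × ℝ) (l : ℝ × ℝ)
    (hv : ∀ i, v (i + m) = v i)
    (hpar : ∀ i, planeCross (v (i + 1) - v i) l ≠ 0)
    (hinj : ∀ i j, i < j → j < i + m → v i ≠ v j)
    (hadj : ∀ i, planeCross (v (i + 1) - v i) (v (i + 2) - v (i + 1)) = 0 →
      0 < planeCross (v (i + 1) - v i) l * planeCross (v (i + 2) - v (i + 1)) l)
    (hdisj : ∀ i j, i + 1 < j → j + 1 < i + m →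
      Disjoint (segment ℝ (v i) (v (i + 1))) (segment ℝ (v j) (v (j + 1)))) :
    ∑ i ∈ Finset.range m,
      parityInd (RotatesThrough l (v (i + 1) - v i) (v (i + 2) - v (i + 1))) = 1 := by
  have hmod : ∀ i k, v (i + m * k) = v i := by
    intro i k
    induction k with
    | zero => simp
    | succ k ih => rw [Nat.mul_succ, ← add_assoc, hv, ih]
  -- `RotatesThrough` depends on the direction only through the signs of its products with the
  -- sides, so a generic nearby direction gives the same count.
  obtain ⟨l', hl1, hl2⟩ := exists_generic_direction (ι := Fin m)
    (κ := {q : Fin m × Fin m // q.1 < q.2})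
    (show l ≠ 0 from fun h => hpar 0 (by simp [h, planeCross]))
    (fun i => v (i + 1) - v i) (fun i => hpar i) (fun q => v q.1.1 - v q.1.2) (by
      rintro ⟨⟨i, j⟩, h⟩
      exact sub_ne_zero.2 (hinj i j h (by omega)))
  have hs : ∀ i, 0 < planeCross (v (i + 1) - v i) l' * planeCross (v (i + 1) - v i) l := by
    intro i
    have h1 := hl1 ⟨i % m, Nat.mod_lt _ (by omega)⟩
    have h2 := hmod (i % m) (i / m)
    have h3 := hmod (i % m + 1) (i / m)
    rw [Nat.mod_add_div] at h2
    rw [add_right_comm, Nat.mod_add_div] at h3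
    rw [h2, h3]; exact h1
  have hpos : ∀ i, 0 < planeCross (v (i + 1) - v i) l' ↔ 0 < planeCross (v (i + 1) - v i) l :=
    fun i => by
      rcases mul_pos_iff.1 (hs i) with h | h
      · exact iff_of_true h.1 h.2
      · exact iff_of_false (by linarith) (by linarith)
  have hneg : ∀ i, planeCross (v (i + 1) - v i) l' < 0 ↔ planeCross (v (i + 1) - v i) l < 0 :=
    fun i => by
      rcases mul_pos_iff.1 (hs i) with h | h
      · exact iff_of_false (by linarith) (by linarith)
      · exact iff_of_true h.1 h.2
  have hne : ∀ i j, i < j → j < m → planeCross (v i) l' ≠ planeCross (v j) l' := by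
    intro i j hij hj h
    refine hl2 ⟨(⟨i, by omega⟩, ⟨j, hj⟩), hij⟩ ?_
    simp only [planeCross_sub_left, h, sub_self]
  have hll : 0 < l'.1 ^ 2 + l'.2 ^ 2 := by
    by_contra hcon
    refine hne 0 1 (by omega) (by omega) ?_
    have h1 : l'.1 = 0 := by nlinarith [sq_nonneg l'.1, sq_nonneg l'.2]
    have h2 : l'.2 = 0 := by nlinarith [sq_nonneg l'.1, sq_nonneg l'.2]
    simp [planeCross, h1, h2]
  have hfinj : Function.Injective (uprightMap l') := by
    rw [← LinearMap.ker_eq_bot, LinearMap.ker_eq_bot']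
    intro p hp
    have h1 := congrArg Prod.fst hp
    have h2 := congrArg Prod.snd hp
    simp only [uprightMap, LinearMap.coe_mk, AddHom.coe_mk, planeCross, Prod.fst_zero,
      Prod.snd_zero] at h1 h2
    ext
    · have : p.1 * (l'.1 ^ 2 + l'.2 ^ 2) = 0 := by linear_combination l'.2 * h1 + l'.1 * h2
      simpa [hll.ne'] using this
    · have : p.2 * (l'.1 ^ 2 + l'.2 ^ 2) = 0 := by linear_combination l'.2 * h2 - l'.1 * h1
      simpa [hll.ne'] using this
  -- The vertices are renumbered from the leftmost one in the new coordinates; periodicity makes the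
  -- sum insensitive to the shift.
  obtain ⟨k, hk, hmin⟩ := Finset.exists_min_image (Finset.range m) (fun i => planeCross (v i) l')
    ⟨0, by simp; omega⟩
  have hmin' : ∀ i, planeCross (v k) l' ≤ planeCross (v i) l' := by
    intro i
    have h2 := hmod (i % m) (i / m)
    rw [Nat.mod_add_div] at h2
    rw [h2]
    exact hmin _ (Finset.mem_range.2 (Nat.mod_lt _ (by omega)))
  have hfst : ∀ p, (uprightMap l' p).1 = planeCross p l' := fun _ => rfl
  have hmain := parity_polygon_of_leftmost m hm (fun i => uprightMap l' (v (i + k)))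
    (fun i => by
      show uprightMap l' (v (i + m + k)) = _
      rw [add_right_comm, hv]) ?_ ?_ ?_ ?_
  · rw [← sum_range_shift_of_periodic m k _ ?_, ← hmain]
    · refine Finset.sum_congr rfl fun i _ => parityInd_congr ?_
      rw [show i + k + 1 = i + 1 + k by ring, show i + k + 2 = i + 2 + k by ring]
      have h1 := hpos (i + k)
      have h2 := hneg (i + k)
      have h3 := hpos (i + k + 1)
      have h4 := hneg (i + k + 1)
      rw [show i + k + 1 + 1 = i + 2 + k by ring] at h3 h4
      rw [show i + k + 1 = i + 1 + k by ring] at h1 h2 h3 h4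
      unfold RotatesThrough TurnsUp
      rw [← h1, ← h2, ← h3, ← h4]
      simp only [hfst, ← map_sub, planeCross_uprightMap, planeCross_sub_left _ _ l', sub_pos,
        sub_neg, mul_pos_iff_of_pos_left hll, mul_neg_iff, hll, hll.not_gt, true_and, false_and,
        or_false]
    · intro i
      rw [show i + m + 1 = i + 1 + m by ring, show i + m + 2 = i + 2 + m by ring, hv, hv, hv]
  · intro i j hij hj h
    simp only [hfst] at h
    have hi1 := Nat.mod_lt (i + k) (show 0 < m by omega)
    have hj1 := Nat.mod_lt (j + k) (show 0 < m by omega)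
    have h1 := hmod ((i + k) % m) ((i + k) / m)
    have h2 := hmod ((j + k) % m) ((j + k) / m)
    rw [Nat.mod_add_div] at h1 h2
    rw [h1, h2] at h
    rcases lt_trichotomy ((i + k) % m) ((j + k) % m) with h3 | h3 | h3
    · exact hne _ _ h3 hj1 h
    · have h4 : i ≡ j [MOD m] := Nat.ModEq.add_right_cancel' k h3
      rw [Nat.ModEq, Nat.mod_eq_of_lt hj, Nat.mod_eq_of_lt (hij.trans hj)] at h4
      omega
    · exact hne _ _ h3 hi1 h.symm
  · intro i
    simp only [hfst, zero_add]
    exact hmin' _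
  · intro i h0
    simp only [← map_sub, planeCross_uprightMap, mul_eq_zero, hll.ne', false_or] at h0
    rw [show i + 1 + k = i + k + 1 by ring, show i + 2 + k = i + k + 2 by ring] at h0 ⊢
    have h1 := hadj (i + k) h0
    simp only [hfst]
    have h3 := hpos (i + k)
    have h4 := hneg (i + k)
    have h5 := hpos (i + k + 1)
    have h6 := hneg (i + k + 1)
    rw [planeCross_sub_left _ _ l', sub_pos] at h3
    rw [planeCross_sub_left _ _ l', sub_neg] at h4
    rw [planeCross_sub_left _ _ l', sub_pos] at h5
    rw [planeCross_sub_left _ _ l', sub_neg] at h6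
    rw [h3, h6]
    rcases mul_pos_iff.1 h1 with h | h
    · intro hh; linarith [hh.1 h.1]
    · intro hh; linarith [hh.2 h.2]
  · intro i j hij hj h0
    have := hdisj (i + k) (j + k) (by omega) (by omega)
    rw [show i + k + 1 = i + 1 + k by ring, show j + k + 1 = j + 1 + k by ring] at this
    have h := (Set.disjoint_image_iff hfinj).2 this
    have e := image_segment ℝ (uprightMap l').toAffineMap
    simp only [LinearMap.coe_toAffineMap] at e
    rwa [e, e] at h


/-! ### Signs of closed walks -/

theorem orient_eq_one_iff (u v : ℝ × ℝ) : PBDTPGraph.orient u v = 1 ↔ 0 < planeCross u v := by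
  unfold PBDTPGraph.orient
  rcases lt_trichotomy (planeCross u v) 0 with h | h | h
  · simp [sign_neg h, h.le]
  · simp [h]
  · simp [sign_pos h, h]

theorem orient_eq_neg_one_iff (u v : ℝ × ℝ) :
    PBDTPGraph.orient u v = -1 ↔ planeCross u v < 0 := by
  unfold PBDTPGraph.orient
  rcases lt_trichotomy (planeCross u v) 0 with h | h | h
  · simp [sign_neg h, h]
  · simp [h]
  · simp [sign_pos h, h.le]

theorem planeCross_swap (u v : ℝ × ℝ) : planeCross u v = - planeCross v u := by
  simp only [planeCross]; ring

theorem prod_sign_eq_neg_one {P : ℕ → Prop} {f : ℕ → ℝ} (m : ℕ) (h1 : ∀ k, P k → f k = -1)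
    (h0 : ∀ k, ¬P k → f k = 1) (hsum : ∑ k ∈ Finset.range m, parityInd (P k) = 1) :
    ∏ k ∈ Finset.range m, f k = -1 := by
  have key : ∀ r, (∑ k ∈ Finset.range r, parityInd (P k) = 0 ∧ ∏ k ∈ Finset.range r, f k = 1) ∨
      (∑ k ∈ Finset.range r, parityInd (P k) = 1 ∧ ∏ k ∈ Finset.range r, f k = -1) := by
    intro r
    induction r with
    | zero => simp
    | succ r ih =>
      rw [Finset.sum_range_succ, Finset.prod_range_succ]
      have h2 : (1 : ZMod 2) + 1 = 0 := by decide
      by_cases hP : P r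
      · rw [parityInd_true hP, h1 r hP]
        rcases ih with h | h <;> simp [h, h2]
      · rw [parityInd_false hP, h0 r hP]
        rcases ih with h | h <;> simp [h]
  rcases key m with h | h
  · rw [h.1] at hsum; exact absurd hsum (by decide)
  · exact h.2

namespace PBDTPGraph

variable {n : ℕ} {V E : Type*} [Fintype V] [Fintype E]

/-- The sign of a pair of consecutive edges. -/
def stepSign (G : PBDTPGraph n V E) (l : ℝ × ℝ) (e f : E) : ℝ := (-1 : ℝ) ^ G.windPair l e f

/-- The sign of an edge. -/
def edgeSign (G : PBDTPGraph n V E) (l : ℝ × ℝ) (e : E) : ℝ := (-1 : ℝ) ^ G.intEdge l e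

variable (G : PBDTPGraph n V E) (l : ℝ × ℝ)

theorem pathSign_singleton (e : E) : G.pathSign l [e] = G.edgeSign l e := by
  simp [pathSign, wind, intPath, edgeSign]

theorem pathSign_cons_cons (e f : E) (P : List E) :
    G.pathSign l (e :: f :: P) =
      G.edgeSign l e * G.stepSign l e f * G.pathSign l (f :: P) := by
  have h : (-1 : ℝ) ≠ 0 := by norm_num
  unfold pathSign edgeSign stepSign
  rw [← zpow_natCast (-1 : ℝ) (G.intEdge l e), ← zpow_add₀ h, ← zpow_add₀ h]
  congr 1
  simp only [wind, intPath, List.map_cons, List.sum_cons]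
  push_cast; ring

theorem pathSign_append (L R : List E) (e f : E) :
    G.pathSign l (L ++ e :: f :: R) =
      G.pathSign l (L ++ [e]) * G.stepSign l e f * G.pathSign l (f :: R) := by
  induction L with
  | nil => rw [List.nil_append, List.nil_append, pathSign_singleton, pathSign_cons_cons]
  | cons a L ih =>
    cases L with
    | nil =>
      simp only [List.cons_append, List.nil_append, pathSign_cons_cons, pathSign_singleton]; ring
    | cons b L =>
      simp only [List.cons_append] at ih ⊢
      rw [pathSign_cons_cons, ih, pathSign_cons_cons]; ring

theorem abs_pathSign (P : List E) : |G.pathSign l P| = 1 := by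
  unfold pathSign; rw [abs_zpow]; simp

/-- The factor for the closing corner turns the sign of a list into a cyclic product. -/
theorem pathSign_map_range (c : ℕ → E) (m : ℕ) :
    G.pathSign l ((List.range (m + 1)).map c) * G.stepSign l (c m) (c (m + 1)) =
      ∏ k ∈ Finset.range (m + 1), (G.edgeSign l (c k) * G.stepSign l (c k) (c (k + 1))) := by
  induction m with
  | zero => simp [pathSign_singleton]
  | succ m ih =>
    rw [Finset.prod_range_succ, ← ih, List.range_succ, List.range_succ, List.map_append,
      List.map_append, List.append_assoc]
    simp only [List.map_cons, List.map_nil, List.cons_append, List.nil_append]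
    rw [pathSign_append, pathSign_singleton]; ring

theorem stepSign_of_rotatesThrough {e f : E} (h : RotatesThrough l (G.dir e) (G.dir f)) :
    G.stepSign l e f = -1 := by
  unfold stepSign windPair
  simp only [orient_eq_one_iff, orient_eq_neg_one_iff, planeCross_swap l (G.dir f), neg_pos,
    neg_lt_zero]
  rcases h with ⟨h1, h2, h3⟩ | ⟨h1, h2, h3⟩
  · rw [if_pos ⟨h3, h1, h2⟩]; simp
  · rw [if_neg (fun h => by linarith [h.1]), if_pos ⟨h3, h1, h2⟩]; simp

theorem stepSign_of_not_rotatesThrough {e f : E} (h : ¬RotatesThrough l (G.dir e) (G.dir f)) :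
    G.stepSign l e f = 1 := by
  unfold stepSign windPair
  simp only [orient_eq_one_iff, orient_eq_neg_one_iff, planeCross_swap l (G.dir f), neg_pos,
    neg_lt_zero]
  rw [if_neg, if_neg]
  · simp
  · exact fun h1 => h (Or.inr ⟨h1.2.1, h1.2.2, h1.1⟩)
  · exact fun h1 => h (Or.inl ⟨h1.2.1, h1.2.2, h1.1⟩)

/-! ### Local structure of the graph and crossings with the gauge rays -/

variable {G}

theorem boundary_edge_unique {i : Fin n} {e f : E} (he : G.src e = Sum.inl i ∨ G.tgt e = Sum.inl i)
    (hf : G.src f = Sum.inl i ∨ G.tgt f = Sum.inl i) : e = f := by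
  obtain ⟨a, ha⟩ := Set.ncard_eq_one.1 (G.boundary_degree i)
  have h1 : e ∈ ({a} : Set E) := ha ▸ he
  have h2 : f ∈ ({a} : Set E) := ha ▸ hf
  exact h1.trans h2.symm

/-- A boundary vertex has degree one, so an edge arriving there and one leaving it would be the same
edge, a loop. -/
theorem not_boundary_of_consecutive {e f : E} (h : G.tgt e = G.src f) (i : Fin n) :
    G.src f ≠ Sum.inl i := by
  intro hf
  have := boundary_edge_unique (Or.inr (h.trans hf)) (Or.inl hf)
  subst this
  exact G.src_ne_tgt e h.symm

/-- A walk without repeated edges can therefore not pass twice through an internal vertex with four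
different edges. -/
theorem perfect_unique {v : V} {e e' f f' : E} (he : G.tgt e = Sum.inr v)
    (he' : G.tgt e' = Sum.inr v) (hf : G.src f = Sum.inr v) (hf' : G.src f' = Sum.inr v) :
    e = e' ∨ f = f' := by
  rcases G.perfect v with h | h <;> obtain ⟨a, ha⟩ := Set.ncard_eq_one.1 h
  · have h1 : e ∈ ({a} : Set E) := ha ▸ he
    have h2 : e' ∈ ({a} : Set E) := ha ▸ he'
    exact Or.inl (h1.trans h2.symm)
  · have h1 : f ∈ ({a} : Set E) := ha ▸ hf
    have h2 : f' ∈ ({a} : Set E) := ha ▸ hf'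
    exact Or.inr (h1.trans h2.symm)

theorem planeCross_add_smul (a b l : ℝ × ℝ) (t : ℝ) :
    planeCross (a + t • l - b) l = planeCross (a - b) l := by
  simp [planeCross]; ring

theorem planeCross_combination (a b c l : ℝ × ℝ) {s t : ℝ} (h : s + t = 1) :
    planeCross (s • a + t • b - c) l = s * planeCross (a - c) l + t * planeCross (b - c) l := by
  obtain rfl : s = 1 - t := by linarith
  simp [planeCross]; ring

variable {l}

/-- The gauge rays point to the inner side of the boundary interval. -/
theorem IsGaugeDirection.boundary_side (hl : G.IsGaugeDirection l) (i : Fin n) {x : ℝ × ℝ}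
    (hx : x ∈ interior G.disk) {t : ℝ} (ht : x = G.pos (Sum.inl i) + t • l) : 0 < t := by
  obtain ⟨p, q, τ, -, hside, -, hpos⟩ := G.boundary_clockwise
  obtain ⟨t₀, ht₀, hmem⟩ := hl.points_inside i
  have h1 := hside _ hmem
  have h2 := hside _ hx
  have e : ∀ s : ℝ, planeCross (q - p) (G.pos (Sum.inl i) + s • l - p) =
      s * planeCross (q - p) l := fun s => by
    rw [(hpos i).2]; simp [planeCross]; ring
  rw [e] at h1
  rw [ht, e] at h2
  have h3 : planeCross (q - p) l < 0 := by
    by_contra hcon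
    nlinarith
  by_contra hcon
  nlinarith

theorem IsGaugeDirection.ne_zero (hl : G.IsGaugeDirection l) (i : Fin n) : l ≠ 0 := by
  rintro rfl
  obtain ⟨t, -, ht⟩ := hl.points_inside i
  exact (lt_irrefl _ (hl.boundary_side i ht (t := 0) (by simp)))

theorem exists_eq_add_smul {a x l : ℝ × ℝ} (hl : l ≠ 0) (h : planeCross (x - a) l = 0) :
    ∃ t : ℝ, x = a + t • l := by
  simp only [planeCross, Prod.fst_sub, Prod.snd_sub] at h
  by_cases h1 : l.1 = 0
  · have h2 : l.2 ≠ 0 := fun h2 => hl (Prod.ext h1 h2)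
    refine ⟨(x.2 - a.2) / l.2, ?_⟩
    ext
    · rw [h1] at h
      have : x.1 - a.1 = 0 := by simpa [h2] using h
      simp [h1]; linarith
    · simp [h2]
  · refine ⟨(x.1 - a.1) / l.1, ?_⟩
    ext
    · simp [h1]
    · simp; field_simp; linarith

/-- The edge is inside the open disk, which meets the full line through b_i only in the ray. Hence
crossing the ray means that the end points are on different sides of the line, and no vertex lies on
it. -/
theorem IsGaugeDirection.ray_meets_segment_iff (hl : G.IsGaugeDirection l) (i : Fin n) (u v : V) :
    (G.gaugeRay l i ∩ segment ℝ (G.pos (Sum.inr u)) (G.pos (Sum.inr v))).Nonempty ↔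
      ¬(0 < planeCross (G.pos (Sum.inr u) - G.pos (Sum.inl i)) l ↔
        0 < planeCross (G.pos (Sum.inr v) - G.pos (Sum.inl i)) l) := by
  have hne : ∀ v : V, planeCross (G.pos (Sum.inr v) - G.pos (Sum.inl i)) l ≠ 0 := by
    intro v h
    obtain ⟨t, ht⟩ := exists_eq_add_smul (hl.ne_zero i) h
    exact hl.no_vertex i v t (hl.boundary_side i (G.internal_mem v) ht).le ht.symm
  have hu := hne u
  have hv := hne v
  set a := planeCross (G.pos (Sum.inr u) - G.pos (Sum.inl i)) l with ha
  set b := planeCross (G.pos (Sum.inr v) - G.pos (Sum.inl i)) l with hb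
  constructor
  · rintro ⟨x, ⟨t, ht, rfl⟩, ⟨s, r, hs, hr, hsr, hx⟩⟩ hiff
    have h1 := planeCross_combination (G.pos (Sum.inr u)) (G.pos (Sum.inr v))
      (G.pos (Sum.inl i)) l hsr
    rw [hx, planeCross_add_smul, sub_self, ← ha, ← hb] at h1
    have h0 : planeCross 0 l = 0 := by simp [planeCross]
    rw [h0] at h1
    rcases lt_or_gt_of_ne hu with h | h
    · have h' : b < 0 := lt_of_le_of_ne (not_lt.1 fun hb' => h.not_gt (hiff.2 hb')) hv
      rcases hs.eq_or_lt with rfl | hs'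
      · nlinarith
      · nlinarith
    · have h' := hiff.1 h
      rcases hs.eq_or_lt with rfl | hs'
      · nlinarith
      · nlinarith
  · intro hiff
    have hab : 0 < a ∧ b < 0 ∨ a < 0 ∧ 0 < b := by
      rcases lt_or_gt_of_ne hu with h | h <;> rcases lt_or_gt_of_ne hv with h' | h'
      · exact absurd (iff_of_false h.not_gt h'.not_gt) hiff
      · exact Or.inr ⟨h, h'⟩
      · exact Or.inl ⟨h, h'⟩
      · exact absurd (iff_of_true h h') hiff
    have hd : b - a ≠ 0 := by rcases hab with h | h <;> intro h0 <;> linarith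
    -- The coefficients b/(b - a) and -a/(b - a) locate the zero of the affine function that has
    -- values a and b at the two end points.
    have hs : 0 ≤ b / (b - a) := by
      rcases hab with h | h
      · exact div_nonneg_of_nonpos h.2.le (by linarith)
      · exact div_nonneg h.2.le (by linarith)
    have hr : 0 ≤ -a / (b - a) := by
      rcases hab with h | h
      · exact div_nonneg_of_nonpos (by linarith) (by linarith)
      · exact div_nonneg (by linarith) (by linarith)
    have hsr : b / (b - a) + -a / (b - a) = 1 := by field_simp; ring
    have h1 := planeCross_combination (G.pos (Sum.inr u)) (G.pos (Sum.inr v))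
      (G.pos (Sum.inl i)) l hsr
    rw [← ha, ← hb] at h1
    have h2 : b / (b - a) * a + -a / (b - a) * b = 0 := by field_simp; ring
    rw [h2] at h1
    obtain ⟨t, ht⟩ := exists_eq_add_smul (hl.ne_zero i) h1
    have hmem := G.disk_convex.interior (G.internal_mem u) (G.internal_mem v) hs hr hsr
    exact ⟨_, ⟨t, hl.boundary_side i hmem ht, ht⟩, ⟨_, _, hs, hr, hsr, rfl⟩⟩

variable (G l) in
open scoped Classical in
/-- The sign of the position of a vertex with respect to the gauge rays of the sources. -/
def sideSign (x : Fin n ⊕ V) : ℝ :=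
  ∏ i : Fin n with G.IsSource i,
    if 0 < planeCross (G.pos x - G.pos (Sum.inl i)) l then (-1 : ℝ) else 1

theorem sideSign_mul_self (x : Fin n ⊕ V) : G.sideSign l x * G.sideSign l x = 1 := by
  unfold sideSign
  rw [← Finset.prod_mul_distrib]
  refine Finset.prod_eq_one fun i _ => ?_
  split_ifs <;> norm_num

/-- This writes the crossing sign as a ratio of signs at the two end points, so that it cancels
around a closed walk. -/
theorem IsGaugeDirection.edgeSign_eq (hl : G.IsGaugeDirection l) {e : E} {u v : V}
    (hu : G.src e = Sum.inr u) (hv : G.tgt e = Sum.inr v) :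
    G.edgeSign l e = G.sideSign l (G.src e) * G.sideSign l (G.tgt e) := by
  classical
  unfold edgeSign intEdge sideSign
  rw [← Finset.prod_mul_distrib, hu, hv]
  have e1 : {i | G.IsSource i ∧ (G.gaugeRay l i ∩
      segment ℝ (G.pos (Sum.inr u)) (G.pos (Sum.inr v))).Nonempty} =
      ((Finset.univ.filter fun i => G.IsSource i).filter fun i => (G.gaugeRay l i ∩
        segment ℝ (G.pos (Sum.inr u)) (G.pos (Sum.inr v))).Nonempty : Finset (Fin n)) := by
    ext i; simp
  rw [e1, Set.ncard_coe_finset, ← Finset.prod_const, Finset.prod_filter]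
  refine Finset.prod_congr rfl fun i _ => ?_
  rw [hl.ray_meets_segment_iff]
  by_cases h1 : 0 < planeCross (G.pos (Sum.inr u) - G.pos (Sum.inl i)) l <;>
    by_cases h2 : 0 < planeCross (G.pos (Sum.inr v) - G.pos (Sum.inl i)) l <;> simp [h1, h2]

theorem exists_smul_of_planeCross_eq_zero {a b : ℝ × ℝ} (ha : a ≠ 0) (h : planeCross a b = 0) :
    ∃ t : ℝ, b = t • a := by
  obtain ⟨t, ht⟩ := exists_eq_add_smul (a := 0) (x := b) ha (by
    rw [sub_zero, planeCross_swap, h, neg_zero])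
  exact ⟨t, by simpa using ht⟩

/-- The sign of a simple closed walk. -/
theorem IsGaugeDirection.prod_sign_cycle (hl : G.IsGaugeDirection l) {m : ℕ} (hm : 0 < m)
    {c : ℕ → E} (hper : ∀ k, c (k + m) = c k) (hchain : ∀ k, G.tgt (c k) = G.src (c (k + 1)))
    (hinj : ∀ i j, i < j → j < i + m → c i ≠ c j) :
    ∏ k ∈ Finset.range m, (G.edgeSign l (c k) * G.stepSign l (c k) (c (k + 1))) = -1 := by
  have hpred : ∀ k, G.tgt (c (k + (m - 1))) = G.src (c k) := fun k => by
    rw [hchain, add_assoc, Nat.sub_add_cancel hm, hper]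
  have hint : ∀ k, ∃ v, G.src (c k) = Sum.inr v := by
    intro k
    rcases h : G.src (c k) with i | v
    · exact absurd h (not_boundary_of_consecutive (hpred k) i)
    · exact ⟨v, rfl⟩
  -- Distinct edges have distinct initial vertices: at a common one, perfectness would identify the
  -- two edges or their predecessors.
  have hsrc : ∀ i j, i < j → j < i + m → G.src (c i) ≠ G.src (c j) := by
    intro i j hij hj h
    obtain ⟨v, hv⟩ := hint i
    rcases perfect_unique ((hpred i).trans hv) ((hpred j).trans (h ▸ hv)) hv (h ▸ hv) with h1 | h1
    · exact hinj _ _ (by omega) (by omega) h1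
    · exact hinj _ _ hij hj h1
  have hdir : ∀ k, G.dir (c k) = G.pos (G.src (c (k + 1))) - G.pos (G.src (c k)) := fun k => by
    unfold dir; rw [hchain]
  have hplanar : ∀ i j, i < j → j < i + m →
      Disjoint (openSegment ℝ (G.pos (G.src (c i))) (G.pos (G.src (c (i + 1)))))
        (segment ℝ (G.pos (G.src (c j))) (G.pos (G.src (c (j + 1))))) := by
    intro i j hij hj
    rw [← hchain, ← hchain]
    exact G.planar _ _ (hinj i j hij hj)
  have hplanar' : ∀ i j, i < j → j < i + m →
      Disjoint (openSegment ℝ (G.pos (G.src (c j))) (G.pos (G.src (c (j + 1)))))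
        (segment ℝ (G.pos (G.src (c i))) (G.pos (G.src (c (i + 1))))) := by
    intro i j hij hj
    rw [← hchain, ← hchain]
    exact G.planar _ _ (hinj i j hij hj).symm
  have hm1 : m ≠ 1 := by
    rintro rfl
    exact G.src_ne_tgt (c 0) (by rw [hchain, hper])
  -- Two straight edges with the same end points coincide as segments, against planarity.
  have hm2 : m ≠ 2 := by
    rintro rfl
    have h := hplanar 0 1 (by omega) (by omega)
    have h2 : c (1 + 1) = c 0 := hper 0
    rw [h2, zero_add, segment_symm] at h
    exact Set.not_disjoint_iff.2 ⟨_, midpoint_mem_openSegment _ _,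
      openSegment_subset_segment ℝ _ _ (midpoint_mem_openSegment _ _)⟩ h
  have hpar : ∀ k, planeCross (G.dir (c k)) l ≠ 0 := by
    intro k
    obtain ⟨u, hu⟩ := hint k
    obtain ⟨v, hv⟩ := hint (k + 1)
    exact hl.not_parallel (c k) u v hu ((hchain k).trans hv)
  have hpoly := parity_polygon m (by omega) (fun k => G.pos (G.src (c k))) l
    (fun i => by simp only [hper]) (fun i => by rw [← hdir]; exact hpar i)
    (fun i j hij hj h => hsrc i j hij hj (G.pos_injective h)) ?_ ?_
  · have hwind : ∏ k ∈ Finset.range m, G.stepSign l (c k) (c (k + 1)) = -1 := by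
      refine prod_sign_eq_neg_one m (P := fun k =>
        RotatesThrough l (G.dir (c k)) (G.dir (c (k + 1))))
        (fun k => G.stepSign_of_rotatesThrough l) (fun k => G.stepSign_of_not_rotatesThrough l) ?_
      rw [← hpoly]
      refine Finset.sum_congr rfl fun k _ => ?_
      rw [hdir, hdir]
    have hedge : ∏ k ∈ Finset.range m, G.edgeSign l (c k) = 1 := by
      have h1 : ∀ k ∈ Finset.range m, G.edgeSign l (c k) =
          G.sideSign l (G.src (c k)) * G.sideSign l (G.src (c (k + 1))) := by
        intro k _
        obtain ⟨u, hu⟩ := hint k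
        obtain ⟨v, hv⟩ := hint (k + 1)
        rw [hl.edgeSign_eq hu ((hchain k).trans hv), hchain]
      have h2 : ∏ k ∈ Finset.range m, G.sideSign l (G.src (c (k + 1))) =
          ∏ k ∈ Finset.range m, G.sideSign l (G.src (c k)) := by
        obtain ⟨r, rfl⟩ : ∃ r, m = r + 1 := ⟨m - 1, by omega⟩
        rw [Finset.prod_range_succ, Finset.prod_range_succ']
        have := hper 0
        rw [zero_add] at this
        rw [this]
      rw [Finset.prod_congr rfl h1, Finset.prod_mul_distrib, h2, ← Finset.prod_mul_distrib]
      exact Finset.prod_eq_one fun k _ => sideSign_mul_self _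
    rw [Finset.prod_mul_distrib, hwind, hedge, one_mul]
  · intro i h0
    have hd1 : G.pos (G.src (c (i + 1))) - G.pos (G.src (c i)) ≠ 0 :=
      sub_ne_zero.2 fun h => hsrc i (i + 1) (by omega) (by omega) (G.pos_injective h).symm
    obtain ⟨t, ht⟩ := exists_smul_of_planeCross_eq_zero hd1 h0
    have hc : ∀ a : ℝ × ℝ, planeCross (t • a) l = t * planeCross a l := fun a => by
      simp [planeCross]; ring
    have hp1 := hpar i
    rw [hdir] at hp1
    simp only [ht, hc]
    -- For t < 0 the second edge would fold back onto the first. The point (B - tA)/(1 - t) lies on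
    -- both, in the interior of AB; the same two coefficients express it through A, B and through B,
    -- C.
    have htpos : 0 < t := by
      by_contra hcon
      rcases (not_lt.1 hcon).eq_or_lt with h | h
      · rw [h, zero_smul, sub_eq_zero] at ht
        exact hsrc (i + 1) (i + 2) (by omega) (by omega) (G.pos_injective ht).symm
      · set A := G.pos (G.src (c i))
        set B := G.pos (G.src (c (i + 1))) with hB
        have hC : G.pos (G.src (c (i + 1 + 1))) = B + t • (B - A) := by
          rw [← ht]; simp
        have hplan := hplanar i (i + 1) (by omega) (by omega)
        rw [hC] at hplan
        have ht1 : 0 < 1 - t := by linarith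
        have hs : -t / (1 - t) + 1 / (1 - t) = 1 := by field_simp; ring
        have hX : (-t / (1 - t)) • A + (1 / (1 - t)) • B ∈ openSegment ℝ A B :=
          ⟨_, _, div_pos (by linarith) ht1, by positivity, hs, rfl⟩
        refine Set.disjoint_left.1 hplan hX
          ⟨(-t / (1 - t)), (1 / (1 - t)), (div_pos (by linarith) ht1).le, by positivity, hs, ?_⟩
        ext <;> simp <;> field_simp <;> ring
    have := mul_self_pos.2 hp1
    nlinarith
  · intro i j hij hj
    rw [Set.disjoint_left]
    intro x hx hx'
    have h1 := fun h => Set.disjoint_left.1 (hplanar i j (by omega) (by omega)) h hx'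
    have h2 := fun h => Set.disjoint_left.1 (hplanar' i j (by omega) (by omega)) h hx
    rw [← insert_endpoints_openSegment] at hx hx'
    have hne : ∀ a b, a < b → b < a + m → x = G.pos (G.src (c a)) → x ≠ G.pos (G.src (c b)) :=
      fun a b hab hb ha hb' => hsrc a b hab hb (G.pos_injective (ha.symm.trans hb'))
    rcases hx with h | h | h
    · rcases hx' with h' | h' | h'
      · exact hne i j (by omega) (by omega) h h'
      · exact hne i (j + 1) (by omega) (by omega) h h'
      · exact h2 h'
    · rcases hx' with h' | h' | h'
      · exact hne (i + 1) j (by omega) (by omega) h h'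
      · exact hne (i + 1) (j + 1) (by omega) (by omega) h h'
      · exact h2 h'
    · exact h1 h

/-- The sign of a closed walk without repeated edges. -/
theorem IsGaugeDirection.pathSign_closed (hl : G.IsGaugeDirection l) {L : List E} {e f : E}
    (hchain : L.IsChain fun a b => G.tgt a = G.src b) (hnodup : L.Nodup) (hf : L.head? = some f)
    (he : L.getLast? = some e) (hef : G.tgt e = G.src f) :
    G.pathSign l L * G.stepSign l e f = -1 := by
  have hne : L ≠ [] := by rintro rfl; simp at hf
  have hpos : 0 < L.length := List.length_pos_iff.2 hne
  obtain ⟨m, hm⟩ : ∃ m, L.length = m + 1 := ⟨L.length - 1, by omega⟩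
  -- The list is extended periodically, so that the closing corner is treated like all others.
  set c : ℕ → E := fun k => L[k % L.length]'(Nat.mod_lt _ hpos) with hc
  have hL : L = (List.range (m + 1)).map c := by
    refine List.ext_getElem (by simp [hm]) fun k h1 h2 => ?_
    simp [hc, Nat.mod_eq_of_lt h1]
  have hcm : c m = e := by
    have : m % L.length = L.length - 1 := by rw [hm]; simp
    simp only [hc, this]
    rw [List.getLast?_eq_getElem?, List.getElem?_eq_getElem (by omega)] at he
    exact Option.some.inj he
  have hcm1 : c (m + 1) = f := by
    have : (m + 1) % L.length = 0 := by rw [hm]; simp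
    simp only [hc, this]
    rw [List.head?_eq_getElem?, List.getElem?_eq_getElem hpos] at hf
    exact Option.some.inj hf
  have hmain := hl.prod_sign_cycle (m := m + 1) (c := c) (Nat.succ_pos m) (fun k => by
    simp [hc, hm]) (fun k => ?_) (fun i j hij hj h => ?_)
  · rw [← hmain, ← pathSign_map_range, ← hL, hcm, hcm1]
  · have hk : k % L.length < L.length := Nat.mod_lt _ hpos
    by_cases hlast : k % L.length + 1 < L.length
    · have h1 := List.isChain_iff_getElem.1 hchain (k % L.length) hlast
      have h2 : (k + 1) % L.length = k % L.length + 1 := by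
        rw [Nat.add_mod, Nat.mod_eq_of_lt (a := 1) (by omega), Nat.mod_eq_of_lt hlast]
      simp only [hc, h2]; exact h1
    · have h1 : k % L.length = m := by omega
      have h2 : (k + 1) % L.length = 0 := by
        rw [Nat.add_mod, h1, hm]; simp
      have e1 : c k = c m := by
        simp only [hc, h1, Nat.mod_eq_of_lt (show m < L.length by omega)]
      have e2 : c (k + 1) = c (m + 1) := by
        have : (m + 1) % L.length = 0 := by rw [hm]; simp
        simp only [hc, h2, this]
      rw [e1, e2, hcm, hcm1, hef]
  · have h1 := (hnodup.getElem_inj_iff).1 h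
    rw [← hm] at hj
    have h2 : i ≡ j [MOD L.length] := h1
    have h3 := (Nat.modEq_iff_dvd' hij.le).1 h2
    have := Nat.le_of_dvd (by omega) h3
    omega

end PBDTPGraph

/-! ### Edge flows and their loop-erased walks -/

namespace PBDTPGraph

variable {n : ℕ} {V E : Type*} [Fintype V] [Fintype E] {G : PBDTPGraph n V E}

theorem isWalk_iff {e : E} {j : Fin n} {P : List E} :
    G.IsWalk e j P ↔ (P = [e] ∧ G.tgt e = Sum.inl j) ∨
      ∃ f P', P = e :: P' ∧ G.tgt e = G.src f ∧ G.IsWalk f j P' := by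
  unfold IsWalk
  cases P with
  | nil => simp
  | cons a P =>
    cases P with
    | nil =>
      simp only [List.head?_cons, Option.some.injEq, List.getLast?_singleton, List.cons.injEq,
        and_true]
      constructor
      · rintro ⟨rfl, -, f, rfl, h⟩; exact Or.inl ⟨rfl, h⟩
      · rintro (⟨rfl, h⟩ | ⟨f, P', ⟨rfl, rfl⟩, -, h, -⟩)
        · exact ⟨rfl, List.isChain_singleton _, a, rfl, h⟩
        · simp at h
    | cons b P =>
      simp only [List.head?_cons, Option.some.injEq, List.isChain_cons_cons,
        List.getLast?_cons_cons, List.cons.injEq, reduceCtorEq, and_false, false_and, false_or]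
      constructor
      · rintro ⟨rfl, ⟨h1, h2⟩, h3⟩
        exact ⟨b, b :: P, ⟨rfl, rfl⟩, h1, rfl, h2, h3⟩
      · rintro ⟨f, P', ⟨rfl, rfl⟩, h1, h2, h3, h4⟩
        simp only [List.head?_cons, Option.some.injEq] at h2
        subst h2
        exact ⟨rfl, ⟨h1, h3⟩, h4⟩

theorem IsWalk.eq_cons {e : E} {j : Fin n} {P : List E} (h : G.IsWalk e j P) :
    ∃ P', P = e :: P' := by
  rcases isWalk_iff.1 h with ⟨rfl, -⟩ | ⟨f, P', rfl, -⟩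
  · exact ⟨_, rfl⟩
  · exact ⟨_, rfl⟩

open scoped Classical

theorem inCount_eq (F : Finset E) (x : Fin n ⊕ V) :
    G.inCount F x = (F.filter fun f => G.tgt f = x).card := by
  rw [inCount, ← Set.ncard_coe_finset]; congr 1; ext; simp

theorem outCount_eq (F : Finset E) (x : Fin n ⊕ V) :
    G.outCount F x = (F.filter fun f => G.src f = x).card := by
  rw [outCount, ← Set.ncard_coe_finset]; congr 1; ext; simp

theorem inCount_insert {F : Finset E} {e : E} (he : e ∉ F) (x : Fin n ⊕ V) :
    G.inCount (insert e F) x = G.inCount F x + if G.tgt e = x then 1 else 0 := by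
  rw [inCount_eq, inCount_eq, Finset.filter_insert]
  split_ifs with h
  · rw [Finset.card_insert_of_notMem (by simp [he])]
  · simp

theorem outCount_insert {F : Finset E} {e : E} (he : e ∉ F) (x : Fin n ⊕ V) :
    G.outCount (insert e F) x = G.outCount F x + if G.src e = x then 1 else 0 := by
  rw [outCount_eq, outCount_eq, Finset.filter_insert]
  split_ifs with h
  · rw [Finset.card_insert_of_notMem (by simp [he])]
  · simp

theorem inCount_union {F F' : Finset E} (h : Disjoint F F') (x : Fin n ⊕ V) :
    G.inCount (F ∪ F') x = G.inCount F x + G.inCount F' x := by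
  rw [inCount_eq, inCount_eq, inCount_eq, Finset.filter_union,
    Finset.card_union_of_disjoint (Finset.disjoint_filter_filter h)]

theorem outCount_union {F F' : Finset E} (h : Disjoint F F') (x : Fin n ⊕ V) :
    G.outCount (F ∪ F') x = G.outCount F x + G.outCount F' x := by
  rw [outCount_eq, outCount_eq, outCount_eq, Finset.filter_union,
    Finset.card_union_of_disjoint (Finset.disjoint_filter_filter h)]

theorem inCount_pos {F : Finset E} {f : E} (hf : f ∈ F) : 0 < G.inCount F (G.tgt f) := by
  rw [inCount_eq]; exact Finset.card_pos.2 ⟨f, by simp [hf]⟩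

theorem eq_of_inCount_le_one {F : Finset E} {x : Fin n ⊕ V} (h : G.inCount F x ≤ 1) {a b : E}
    (ha : a ∈ F) (hb : b ∈ F) (hax : G.tgt a = x) (hbx : G.tgt b = x) : a = b := by
  rw [inCount_eq] at h
  exact Finset.card_le_one.1 h a (by simp [ha, hax]) b (by simp [hb, hbx])

theorem eq_of_outCount_le_one {F : Finset E} {x : Fin n ⊕ V} (h : G.outCount F x ≤ 1) {a b : E}
    (ha : a ∈ F) (hb : b ∈ F) (hax : G.src a = x) (hbx : G.src b = x) : a = b := by
  rw [outCount_eq] at h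
  exact Finset.card_le_one.1 h a (by simp [ha, hax]) b (by simp [hb, hbx])

theorem exists_of_outCount_pos {F : Finset E} {x : Fin n ⊕ V} (h : 0 < G.outCount F x) :
    ∃ f ∈ F, G.src f = x := by
  rw [outCount_eq] at h
  obtain ⟨f, hf⟩ := Finset.card_pos.1 h
  exact ⟨f, by simpa using hf⟩

theorem inCount_le_one_or_outCount_le_one (F : Finset E) (v : V) :
    G.inCount F (Sum.inr v) ≤ 1 ∨ G.outCount F (Sum.inr v) ≤ 1 := by
  rcases G.perfect v with h | h
  · exact Or.inl (h ▸ Set.ncard_le_ncard (fun f hf => hf.2) (Set.toFinite _))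
  · exact Or.inr (h ▸ Set.ncard_le_ncard (fun f hf => hf.2) (Set.toFinite _))

variable {j : Fin n}

/-- At `G.src e` one edge more leaves than arrives, so a bound 1 on either count suffices.
Consequently at most two edges of the flow leave this vertex, and at most one leaves any other
internal vertex. -/
theorem IsEdgeFlow.inCount_le_one {e : E} {F : Finset E} (h : G.IsEdgeFlow e j F) (v : V) :
    G.inCount F (Sum.inr v) ≤ 1 := by
  by_cases hv : Sum.inr v = G.src e
  · have := h.2.2.1
    rw [← hv] at this
    rcases G.inCount_le_one_or_outCount_le_one F v with h1 | h1 <;> omega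
  · have := h.2.1 v hv
    rcases G.inCount_le_one_or_outCount_le_one F v with h1 | h1 <;> omega

theorem IsEdgeFlow.not_mem_conservative {e : E} (h : G.tgt e = Sum.inl j) {C : Finset E}
    (hC : G.IsConservativeFlow C) : e ∉ C := fun he => (hC.2 e he j).2 h

/-- Together with `erase_conservative` this is the base of the recursion: when e ends at b_j, its
edge flows are e plus a conservative flow. -/
theorem IsEdgeFlow.of_conservative {e : E} (he : G.tgt e = Sum.inl j) {C : Finset E}
    (hC : G.IsConservativeFlow C) : G.IsEdgeFlow e j (insert e C) := by
  have heC := IsEdgeFlow.not_mem_conservative he hC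
  refine ⟨Finset.mem_insert_self _ _, fun v hv => ?_, ?_, ⟨e, Finset.mem_insert_self _ _, he⟩, ?_⟩
  · rw [inCount_insert heC, outCount_insert heC, he, if_neg (by simp), if_neg hv.symm, hC.1 v]
  · rw [inCount_insert heC, outCount_insert heC, if_pos rfl, if_neg (G.src_ne_tgt e).symm, add_zero]
    congr 1
    rcases h : G.src e with i | v
    · rw [inCount_eq, outCount_eq, Finset.filter_eq_empty_iff.2 fun f hf => (hC.2 f hf i).2,
        Finset.filter_eq_empty_iff.2 fun f hf => (hC.2 f hf i).1]
    · exact hC.1 v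
  · intro f hf i
    rcases Finset.mem_insert.1 hf with rfl | hf
    · exact ⟨fun _ => rfl, fun h => Sum.inl_injective (h.symm.trans he)⟩
    · exact ⟨fun h => absurd h (hC.2 f hf i).1, fun h => absurd h (hC.2 f hf i).2⟩

theorem IsEdgeFlow.eq_of_tgt {e : E} {F : Finset E} (h : G.IsEdgeFlow e j F) {i : Fin n}
    (he : G.tgt e = Sum.inl i) : i = j := (h.2.2.2.2 e h.1 i).2 he

theorem IsEdgeFlow.erase_conservative {e : E} {F : Finset E} (h : G.IsEdgeFlow e j F)
    (he : G.tgt e = Sum.inl j) : G.IsConservativeFlow (F.erase e) := by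
  have hF : insert e (F.erase e) = F := Finset.insert_erase h.1
  refine ⟨fun v => ?_, fun f hf i => ⟨fun hs => ?_, fun ht => ?_⟩⟩
  · have h1 := h.2.1 v
    have h2 := h.2.2.1
    rw [← hF, inCount_insert (Finset.notMem_erase _ _), outCount_insert (Finset.notMem_erase _ _)]
      at h1 h2
    by_cases hv : Sum.inr v = G.src e
    · rw [← hv, he, if_neg (by simp), if_pos rfl] at h2
      omega
    · have h1 := h1 hv
      rw [if_neg (Ne.symm hv), he, if_neg (by simp)] at h1
      simpa using h1
  · exact (Finset.mem_erase.1 hf).1 ((h.2.2.2.2 f (Finset.mem_of_mem_erase hf) i).1 hs)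
  · have hi := (h.2.2.2.2 f (Finset.mem_of_mem_erase hf) i).2 ht
    subst hi
    exact (Finset.mem_erase.1 hf).1 (boundary_edge_unique (Or.inr ht) (Or.inr he))

theorem IsEdgeFlow.next_unique {e : E} {F : Finset E} (h : G.IsEdgeFlow e j F) {f g : E}
    (hf : f ∈ F) (hg : g ∈ F) (hef : G.tgt e = G.src f) (heg : G.tgt e = G.src g) : f = g := by
  rcases hv : G.tgt e with i | v
  · exact absurd (hef.symm.trans hv) (not_boundary_of_consecutive hef i)
  · have h1 := h.2.1 v (by rw [← hv]; exact (G.src_ne_tgt e).symm)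
    have h2 := h.inCount_le_one v
    exact eq_of_outCount_le_one (h1 ▸ h2) hf hg (hef.symm.trans hv) (heg.symm.trans hv)

/-- Removing e moves the excess of leaving edges from the start of e to its end. `IsEdgeFlow.insert`
is the inverse operation. -/
theorem IsEdgeFlow.exists_next {e : E} {F : Finset E} (h : G.IsEdgeFlow e j F) {v : V}
    (he : G.tgt e = Sum.inr v) : ∃ f, G.tgt e = G.src f ∧ G.IsEdgeFlow f j (F.erase e) := by
  have hve : Sum.inr v ≠ G.src e := he ▸ (G.src_ne_tgt e).symm
  have h1 := h.2.1 v hve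
  have h2 : 0 < G.inCount F (Sum.inr v) := he ▸ inCount_pos h.1
  obtain ⟨f, hf, hfv⟩ := exists_of_outCount_pos (h1 ▸ h2)
  have hfe : f ≠ e := by rintro rfl; exact hve hfv.symm
  have hF : insert e (F.erase e) = F := Finset.insert_erase h.1
  have hin := fun x => inCount_insert (G := G) (Finset.notMem_erase e F) x
  have hout := fun x => outCount_insert (G := G) (Finset.notMem_erase e F) x
  rw [hF] at hin hout
  refine ⟨f, he.trans hfv.symm, Finset.mem_erase.2 ⟨hfe, hf⟩, fun u hu => ?_, ?_, ?_, ?_⟩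
  · rw [hfv] at hu
    have h3 := hin (Sum.inr u)
    have h4 := hout (Sum.inr u)
    rw [he, if_neg hu.symm] at h3
    by_cases hue : Sum.inr u = G.src e
    · rw [if_pos hue.symm] at h4
      have h5 := h.2.2.1
      rw [← hue] at h5
      omega
    · rw [if_neg (Ne.symm hue)] at h4
      have h5 := h.2.1 u hue
      omega
  · have h3 := hin (Sum.inr v)
    have h4 := hout (Sum.inr v)
    rw [if_pos he] at h3
    rw [if_neg hve.symm] at h4
    rw [hfv]
    omega
  · obtain ⟨g, hg, hgj⟩ := h.2.2.2.1
    refine ⟨g, Finset.mem_erase.2 ⟨?_, hg⟩, hgj⟩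
    rintro rfl
    rw [he] at hgj
    simp at hgj
  · intro g hg i
    obtain ⟨h5, h6⟩ := Finset.mem_erase.1 hg
    exact ⟨fun h7 => absurd ((h.2.2.2.2 g h6 i).1 h7) h5, (h.2.2.2.2 g h6 i).2⟩

theorem IsEdgeFlow.insert {e f : E} {F : Finset E} (h : G.IsEdgeFlow f j F)
    (hef : G.tgt e = G.src f) (he : e ∉ F) : G.IsEdgeFlow e j (insert e F) := by
  have hb : ∀ g ∈ F, ∀ i, G.src g ≠ Sum.inl i := by
    intro g hg i hgi
    have := (h.2.2.2.2 g hg i).1 hgi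
    subst this
    exact not_boundary_of_consecutive hef i hgi
  have hse := G.src_ne_tgt e
  refine ⟨Finset.mem_insert_self _ _, fun v hv => ?_, ?_, ?_, ?_⟩
  · rw [inCount_insert he, outCount_insert he, if_neg hv.symm]
    by_cases hvf : Sum.inr v = G.src f
    · rw [if_pos (hef.trans hvf.symm), hvf, h.2.2.1, add_zero]
    · rw [if_neg (fun h1 => hvf (h1.symm.trans hef)), h.2.1 v hvf]
  · rw [inCount_insert he, outCount_insert he, if_neg hse.symm, if_pos rfl, add_zero]
    congr 1
    rcases hv : G.src e with i | v
    · rw [inCount_eq, outCount_eq, Finset.filter_eq_empty_iff.2 fun g hg => hb g hg i,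
        Finset.filter_eq_empty_iff.2]
      intro g hg hgi
      have := boundary_edge_unique (Or.inr hgi) (Or.inl hv)
      subst this
      exact he hg
    · exact h.2.1 v (by rw [← hv, ← hef]; exact hse)
  · obtain ⟨g, hg, hgj⟩ := h.2.2.2.1
    exact ⟨g, Finset.mem_insert_of_mem hg, hgj⟩
  · intro g hg i
    rcases Finset.mem_insert.1 hg with rfl | hg
    · refine ⟨fun _ => rfl, fun h1 => ?_⟩
      exact absurd (hef.symm.trans h1) (not_boundary_of_consecutive hef i)
    · exact ⟨fun h1 => absurd h1 (hb g hg i), (h.2.2.2.2 g hg i).2⟩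

theorem IsFlowWalk.cons {e f : E} {F : Finset E} {P : List E} (h : G.IsFlowWalk f j F P)
    (hef : G.tgt e = G.src f) (he : e ∉ F) : G.IsFlowWalk e j (insert e F) (e :: P) := by
  obtain ⟨h1, h2, C, hC, hCP, hF⟩ := h
  have heP := fun h => he ((hF e).2 (Or.inl h))
  have heC := fun h => he ((hF e).2 (Or.inr h))
  refine ⟨isWalk_iff.2 (Or.inr ⟨f, P, rfl, hef, h1⟩), List.nodup_cons.2 ⟨heP, h2⟩, C, hC, ?_, ?_⟩
  · intro g hg
    rw [List.mem_cons, not_or]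
    exact ⟨fun h => heC (h ▸ hg), hCP g hg⟩
  · intro g
    rw [Finset.mem_insert, List.mem_cons, hF, or_assoc]

theorem IsFlowWalk.tail {e : E} {F : Finset E} {P : List E} (h : G.IsFlowWalk e j F (e :: P))
    {v : V} (he : G.tgt e = Sum.inr v) :
    ∃ f, G.tgt e = G.src f ∧ f ∈ F ∧ G.IsFlowWalk f j (F.erase e) P := by
  obtain ⟨h1, h2, C, hC, hCP, hF⟩ := h
  rcases isWalk_iff.1 h1 with ⟨-, h3⟩ | ⟨f, P', h3, h4, h5⟩
  · rw [he] at h3; simp at h3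
  · obtain rfl := (List.cons.inj h3).2
    obtain ⟨Q, rfl⟩ := h5.eq_cons
    have hn := List.nodup_cons.1 h2
    refine ⟨f, h4, (hF f).2 (Or.inl (by simp)), h5, hn.2, C, hC, fun g hg h => ?_, fun g => ?_⟩
    · exact hCP g hg (List.mem_cons_of_mem _ h)
    · rw [Finset.mem_erase, hF, List.mem_cons]
      constructor
      · rintro ⟨h6, (h7 | h7) | h7⟩
        · exact absurd h7 h6
        · exact Or.inl h7
        · exact Or.inr h7
      · rintro (h6 | h6)
        · exact ⟨fun h => hn.1 (h ▸ h6), Or.inl (Or.inr h6)⟩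
        · exact ⟨fun h => hCP g h6 (by simp [h]), Or.inr h6⟩

/-- Every edge flow has exactly one loop-erased walk. -/
theorem IsEdgeFlow.existsUnique_flowWalk {e : E} {F : Finset E} (h : G.IsEdgeFlow e j F) :
    ∃! P, G.IsFlowWalk e j F P := by
  -- The walk is forced: exactly one edge of F leaves an internal end of e, and removing e leaves a
  -- smaller edge flow starting with that edge.
  induction hk : F.card generalizing e F with
  | zero => exact absurd h.1 (by simp [Finset.card_eq_zero.1 hk])
  | succ k ih =>
    rcases hv : G.tgt e with i | v
    · obtain rfl := h.eq_of_tgt hv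
      refine ⟨[e], ⟨isWalk_iff.2 (Or.inl ⟨rfl, hv⟩), by simp, F.erase e,
        h.erase_conservative hv, fun f hf => ?_, fun f => ?_⟩, ?_⟩
      · simpa using (Finset.mem_erase.1 hf).1
      · rw [← Finset.insert_erase h.1]
        simp
      · rintro P ⟨h1, -⟩
        rcases isWalk_iff.1 h1 with ⟨h2, -⟩ | ⟨f, P', -, h2, -⟩
        · exact h2
        · exact absurd (h2.symm.trans hv) (not_boundary_of_consecutive h2 i)
    · obtain ⟨f, hef, hf⟩ := h.exists_next hv
      obtain ⟨P, hP, huniq⟩ := ih hf (by rw [Finset.card_erase_of_mem h.1, hk]; rfl)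
      refine ⟨e :: P, ?_, ?_⟩
      · have := IsFlowWalk.cons hP hef (Finset.notMem_erase e F)
        rwa [Finset.insert_erase h.1] at this
      · intro Q hQ
        obtain ⟨Q, rfl⟩ := hQ.1.eq_cons
        obtain ⟨g, heg, hgF, hg⟩ := hQ.tail hv
        obtain rfl := h.next_unique hgF (Finset.mem_of_mem_erase hf.1) heg hef
        rw [huniq Q hg]

theorem IsFlowWalk.flowWalk_eq {e : E} {F : Finset E} {P : List E} (hP : G.IsFlowWalk e j F P)
    (h : G.IsEdgeFlow e j F) : G.flowWalk e j F = P := by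
  have hex : ∃ P, G.IsFlowWalk e j F P := ⟨P, hP⟩
  rw [flowWalk, dif_pos hex]
  exact h.existsUnique_flowWalk.unique hex.choose_spec hP

theorem IsEdgeFlow.isFlowWalk_flowWalk {e : E} {F : Finset E} (h : G.IsEdgeFlow e j F) :
    G.IsFlowWalk e j F (G.flowWalk e j F) := by
  obtain ⟨P, hP, -⟩ := h.existsUnique_flowWalk
  rwa [hP.flowWalk_eq h]

/-! ### Signs of edge flows and their cancellation -/

variable {l : ℝ × ℝ}

theorem flowSign_insert_conservative {e : E} (he : G.tgt e = Sum.inl j) {C : Finset E}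
    (hC : G.IsConservativeFlow C) : G.flowSign l e j (insert e C) = G.edgeSign l e := by
  have h := IsEdgeFlow.of_conservative he hC
  have hP := h.isFlowWalk_flowWalk
  rw [flowSign]
  rcases isWalk_iff.1 hP.1 with ⟨h2, -⟩ | ⟨f, P', -, h2, -⟩
  · rw [h2, pathSign_singleton]
  · exact absurd (h2.symm.trans he) (not_boundary_of_consecutive h2 j)

theorem IsEdgeFlow.flowSign_insert {e f : E} {F : Finset E} (h : G.IsEdgeFlow f j F)
    (hef : G.tgt e = G.src f) (he : e ∉ F) :
    G.flowSign l e j (Insert.insert e F) =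
      G.edgeSign l e * G.stepSign l e f * G.flowSign l f j F := by
  have hP := h.isFlowWalk_flowWalk
  rw [flowSign, (hP.cons hef he).flowWalk_eq (h.insert hef he), flowSign]
  obtain ⟨Q, hQ⟩ := hP.1.eq_cons
  rw [hQ, pathSign_cons_cons]

/-- For a closed list the two correction terms agree, so its edges are balanced at every vertex and
can be moved into a conservative flow. -/
theorem inCount_toFinset_of_isChain {L : List E} {e f : E}
    (hchain : L.IsChain fun a b => G.tgt a = G.src b) (hnodup : L.Nodup) (hf : L.head? = some f)
    (he : L.getLast? = some e) (x : Fin n ⊕ V) :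
    G.inCount L.toFinset x + (if G.src f = x then 1 else 0) =
      G.outCount L.toFinset x + if G.tgt e = x then 1 else 0 := by
  induction L generalizing f with
  | nil => simp at hf
  | cons a L ih =>
    obtain rfl : a = f := by simpa using hf
    have hn := List.nodup_cons.1 hnodup
    rw [List.toFinset_cons, inCount_insert (by simpa using hn.1),
      outCount_insert (by simpa using hn.1)]
    cases L with
    | nil =>
      obtain rfl : a = e := by simpa using he
      simp [inCount_eq, outCount_eq, add_comm]
    | cons b L =>
      have hc := List.isChain_cons_cons.1 hchain
      rw [List.getLast?_cons_cons] at he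
      have := ih hc.2 hn.2 rfl he
      rw [hc.1]
      omega

/-- Read backwards from the common last edge, both walks are determined, since away from v at most
one edge of F arrives at each vertex. Neither can stop before the other, because the longer one
would then contain an edge arriving at v. -/
theorem head_eq_of_getLast_eq {F : Finset E} {v : V}
    (hF : ∀ a ∈ F, ∀ b ∈ F, G.tgt a = G.tgt b → G.tgt a ≠ Sum.inr v → a = b) {P Q : List E}
    {f g h : E} (hP : P.IsChain fun a b => G.tgt a = G.src b)
    (hQ : Q.IsChain fun a b => G.tgt a = G.src b)
    (hPF : ∀ a ∈ P, a ∈ F ∧ G.tgt a ≠ Sum.inr v) (hQF : ∀ a ∈ Q, a ∈ F ∧ G.tgt a ≠ Sum.inr v)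
    (hf : P.head? = some f) (hg : Q.head? = some g) (hfv : G.src f = Sum.inr v)
    (hgv : G.src g = Sum.inr v) (hPh : P.getLast? = some h) (hQh : Q.getLast? = some h) :
    f = g := by
  induction P using List.reverseRecOn generalizing Q h with
  | nil => simp at hf
  | append_singleton P p ih =>
    rcases List.eq_nil_or_concat' Q with rfl | ⟨Q, q, rfl⟩
    · simp at hg
    simp only [List.getLast?_concat, Option.some.injEq] at hPh hQh
    subst hPh hQh
    rw [List.isChain_append] at hP hQ
    rcases List.eq_nil_or_concat' P with rfl | ⟨P, a, rfl⟩
    · rcases List.eq_nil_or_concat' Q with rfl | ⟨Q, b, rfl⟩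
      · simp only [List.nil_append, List.head?_cons, Option.some.injEq] at hf hg
        exact hf.symm.trans hg
      · simp only [List.nil_append, List.head?_cons, Option.some.injEq] at hf
        subst hf
        have := hQ.2.2 b (by simp) q (by simp)
        exact absurd (this.trans hfv) (hQF b (by simp)).2
    · have h1 := hP.2.2 a (by simp) q (by simp)
      rcases List.eq_nil_or_concat' Q with rfl | ⟨Q, b, rfl⟩
      · simp only [List.nil_append, List.head?_cons, Option.some.injEq] at hg
        subst hg
        exact absurd (h1.trans hgv) (hPF a (by simp)).2
      · have h2 := hQ.2.2 b (by simp) q (by simp)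
        obtain rfl := hF a (hPF a (by simp)).1 b (hQF b (by simp)).1 (h1.trans h2.symm)
          (hPF a (by simp)).2
        refine ih (Q := Q ++ [a]) (h := a) hP.1 hQ.1 (fun c hc => hPF c ?_) (fun c hc => hQF c ?_)
          ?_ ?_ (by simp) (by simp)
        · exact List.mem_append_left _ hc
        · exact List.mem_append_left _ hc
        · rwa [List.head?_append_of_ne_nil _ (by simp)] at hf
        · rwa [List.head?_append_of_ne_nil _ (by simp)] at hg

/-- The walk from f is a closed walk ending in e, followed by the walk from g. The closed part, with
its closing corner from e to f, has sign -1, and the next corner is the one from e to g. -/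
theorem IsGaugeDirection.flowSign_cancel_of_mem (hl : G.IsGaugeDirection l) {e f g : E}
    {F : Finset E} (hF : G.IsEdgeFlow f j F) (hFg : G.IsEdgeFlow g j F) (hfg : f ≠ g)
    (hef : G.tgt e = G.src f) (heg : G.tgt e = G.src g) (he : e ∈ G.flowWalk f j F) :
    G.stepSign l e f * G.flowSign l f j F + G.stepSign l e g * G.flowSign l g j F = 0 := by
  obtain ⟨hwalk, hnodup, C, hC, hCP, hFP⟩ := hF.isFlowWalk_flowWalk
  obtain ⟨L, R, hLR⟩ := List.append_of_mem he
  rw [flowSign, flowSign]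
  rw [hLR] at hwalk hnodup hCP hFP ⊢
  obtain ⟨hhead, hchain, z, hz, hzj⟩ := hwalk
  have hsv : ∃ v, G.src f = Sum.inr v := by
    rcases h : G.src f with i | v
    · exact absurd h (not_boundary_of_consecutive hef i)
    · exact ⟨v, rfl⟩
  obtain ⟨v, hv⟩ := hsv
  have hev := hef.trans hv
  cases R with
  | nil =>
    obtain rfl : e = z := by simpa using hz
    rw [hev] at hzj; simp at hzj
  | cons g' R =>
    have hsplit : L ++ e :: g' :: R = (L ++ [e]) ++ (g' :: R) := by simp
    rw [hsplit] at hnodup hchain hz hhead hCP hFP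
    rw [List.head?_append_of_ne_nil _ (by simp)] at hhead
    rw [List.getLast?_append_of_ne_nil _ (by simp)] at hz
    rw [List.isChain_append] at hchain
    rw [List.nodup_append] at hnodup
    have hg'v : G.src g' = Sum.inr v := by
      rw [← hev]; exact (hchain.2.2 e (by simp) g' (by simp)).symm
    have hfm : f ∈ L ++ [e] := List.mem_of_mem_head? hhead
    have hg'f : f ≠ g' := hnodup.2.2 f hfm g' (by simp)
    -- Otherwise three edges f, g', g of F would leave v, but at most two do.
    obtain rfl : g' = g := by
      by_contra hne
      have h1 := hF.2.2.1
      have h2 := hF.inCount_le_one v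
      rw [hv] at h1
      have h3 : ({f, g', g} : Finset E) ⊆ F.filter fun a => G.src a = Sum.inr v := by
        intro a ha
        simp only [Finset.mem_insert, Finset.mem_singleton] at ha
        rw [Finset.mem_filter]
        rcases ha with rfl | rfl | rfl
        · exact ⟨hF.1, hv⟩
        · exact ⟨(hFP _).2 (Or.inl (by simp)), hg'v⟩
        · exact ⟨hFg.1, by rw [← heg, hev]⟩
      have h4 := Finset.card_le_card h3
      rw [← outCount_eq, Finset.card_eq_three.2 ⟨f, g', g, hg'f, hfg, hne, rfl⟩] at h4
      omega
    have hcount : ∀ x, G.inCount (L ++ [e]).toFinset x = G.outCount (L ++ [e]).toFinset x := by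
      intro x
      have := inCount_toFinset_of_isChain hchain.1 hnodup.1 hhead (by simp) (e := e) x
      rw [hef] at this
      exact Nat.add_right_cancel this
    have hdisj : Disjoint C (L ++ [e]).toFinset := Finset.disjoint_left.2 fun a ha ha' =>
      hCP a ha (List.mem_append_left _ (List.mem_toFinset.1 ha'))
    -- The closed part joins the conservative flow, and what remains is the loop-erased walk of the
    -- same F seen from g.
    have hwalk' : G.IsFlowWalk g' j F (g' :: R) := by
      refine ⟨⟨rfl, hchain.2.1, z, hz, hzj⟩, hnodup.2.1, C ∪ (L ++ [e]).toFinset, ⟨fun u => ?_, ?_⟩,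
        ?_, ?_⟩
      · rw [inCount_union hdisj, outCount_union hdisj, hC.1, hcount]
      · intro a ha i
        rcases Finset.mem_union.1 ha with ha | ha
        · exact hC.2 a ha i
        · have ha' := List.mem_toFinset.1 ha
          have haF : a ∈ F := (hFP a).2 (Or.inl (List.mem_append_left _ ha'))
          refine ⟨fun h => ?_, fun h => ?_⟩
          · obtain rfl := (hF.2.2.2.2 a haF i).1 h
            rw [hv] at h; simp at h
          · obtain rfl := (hF.2.2.2.2 a haF i).2 h
            exact hnodup.2.2 a ha' z (List.mem_of_getLast? hz)
              (boundary_edge_unique (Or.inr h) (Or.inr hzj))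
      · intro a ha h
        rcases Finset.mem_union.1 ha with ha | ha
        · exact hCP a ha (List.mem_append_right _ h)
        · exact hnodup.2.2 a (List.mem_toFinset.1 ha) a h rfl
      · intro a
        rw [hFP, Finset.mem_union, List.mem_toFinset, List.mem_append (s := L ++ [e])]
        tauto
    rw [hwalk'.flowWalk_eq hFg, pathSign_append]
    have hclosed := hl.pathSign_closed hchain.1 hnodup.1 hhead (by simp) hef
    linear_combination (G.stepSign l e g' * G.pathSign l (g' :: R)) * hclosed

/-- The contributions to the edge vectors of an edge flow containing a closed walk through `e` that
starts at one of the two edges following `e` cancel. -/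
theorem IsGaugeDirection.flowSign_cancel (hl : G.IsGaugeDirection l) {e f g : E}
    {F : Finset E} (hF : G.IsEdgeFlow f j F) (hFg : G.IsEdgeFlow g j F) (hfg : f ≠ g)
    (hef : G.tgt e = G.src f) (heg : G.tgt e = G.src g) (heF : e ∈ F) :
    G.stepSign l e f * G.flowSign l f j F + G.stepSign l e g * G.flowSign l g j F = 0 := by
  by_cases h1 : e ∈ G.flowWalk f j F
  · exact hl.flowSign_cancel_of_mem hF hFg hfg hef heg h1
  by_cases h2 : e ∈ G.flowWalk g j F
  · rw [add_comm]
    exact hl.flowSign_cancel_of_mem hFg hF hfg.symm heg hef h2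
  -- As e is the only edge of F arriving at v, neither walk would return to v. Both end with the
  -- unique edge at b_j, so going backwards they would have the same first edge.
  exfalso
  have hsv : ∃ v, G.src f = Sum.inr v := by
    rcases h : G.src f with i | v
    · exact absurd h (not_boundary_of_consecutive hef i)
    · exact ⟨v, rfl⟩
  obtain ⟨v, hv⟩ := hsv
  have hev := hef.trans hv
  obtain ⟨⟨hhead, hchain, z, hz, hzj⟩, -, C, -, -, hFP⟩ := hF.isFlowWalk_flowWalk
  obtain ⟨⟨hhead', hchain', z', hz', hzj'⟩, -, C', -, -, hFP'⟩ := hFg.isFlowWalk_flowWalk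
  obtain rfl := boundary_edge_unique (Or.inr hzj) (Or.inr hzj')
  refine hfg (head_eq_of_getLast_eq (F := F) (v := v) ?_ hchain hchain' ?_ ?_ hhead hhead' hv
    (by rw [← heg, hev]) hz hz')
  · intro a ha b hb hab _
    rcases hx : G.tgt a with i | u
    · exact boundary_edge_unique (Or.inr hx) (Or.inr (hab.symm.trans hx))
    · exact eq_of_inCount_le_one (hF.inCount_le_one u) ha hb hx (hab.symm.trans hx)
  · intro a ha
    have haF := (hFP a).2 (Or.inl ha)
    refine ⟨haF, fun hav => h1 ?_⟩
    rwa [← eq_of_inCount_le_one (hF.inCount_le_one v) haF heF hav hev]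
  · intro a ha
    have haF := (hFP' a).2 (Or.inl ha)
    refine ⟨haF, fun hav => h2 ?_⟩
    rwa [← eq_of_inCount_le_one (hF.inCount_le_one v) haF heF hav hev]

end PBDTPGraph

/-! ### Power series in the edge weights -/

theorem coeff_single_add_X_mul {σ : Type*} (s : σ) (m : σ →₀ ℕ) (φ : MvPowerSeries σ ℝ) :
    MvPowerSeries.coeff (Finsupp.single s 1 + m) (MvPowerSeries.X s * φ) =
      MvPowerSeries.coeff m φ := by
  rw [MvPowerSeries.X_def, MvPowerSeries.coeff_add_monomial_mul, one_mul]

theorem coeff_X_mul_of_eq_zero {σ : Type*} {s : σ} {m : σ →₀ ℕ} (h : m s = 0)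
    (φ : MvPowerSeries σ ℝ) : MvPowerSeries.coeff m (MvPowerSeries.X s * φ) = 0 := by
  classical
  rw [MvPowerSeries.X_def, MvPowerSeries.coeff_monomial_mul, if_neg]
  intro hle
  have := hle s
  simp [h] at this

theorem exists_single_add_of_ne_zero {σ : Type*} {s : σ} {m : σ →₀ ℕ} (h : m s ≠ 0) :
    ∃ m', m = Finsupp.single s 1 + m' :=
  le_iff_exists_add.1 (Finsupp.single_le_iff.2 (Nat.one_le_iff_ne_zero.2 h))

/-- The value of a monomial with a given exponent. -/
def monomialValue {σ : Type*} (w : σ → ℝ) (m : σ →₀ ℕ) : ℝ := m.prod fun e k => w e ^ k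

theorem monomialValue_single_add {σ : Type*} (w : σ → ℝ) (s : σ) (m : σ →₀ ℕ) :
    monomialValue w (Finsupp.single s 1 + m) = w s * monomialValue w m := by
  classical
  rw [monomialValue, Finsupp.prod_add_index' (by simp) (by intros; rw [pow_add]),
    Finsupp.prod_single_index (by simp), pow_one, monomialValue]

theorem hasSum_X_mul {σ : Type*} {w : σ → ℝ} {φ : MvPowerSeries σ ℝ} {S : ℝ} (s : σ)
    (h : HasSum (fun m => MvPowerSeries.coeff m φ * monomialValue w m) S) :
    HasSum (fun m => MvPowerSeries.coeff m (MvPowerSeries.X s * φ) * monomialValue w m)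
      (w s * S) := by
  have hinj : Function.Injective fun m : σ →₀ ℕ => Finsupp.single s 1 + m :=
    fun a b hab => add_left_cancel hab
  rw [← hinj.hasSum_iff]
  · refine (h.mul_left (w s)).congr_fun ?_
    intro m
    simp only [Function.comp, coeff_single_add_X_mul, monomialValue_single_add]
    ring
  · intro m hm
    rw [coeff_X_mul_of_eq_zero, zero_mul]
    by_contra h0
    obtain ⟨m', hm'⟩ := exists_single_add_of_ne_zero h0
    exact hm ⟨m', hm'.symm⟩

/-- Multiplication by a polynomial is built from scalings, sums and the shifts of `hasSum_X_mul`, so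
no product of two infinite sums is needed. -/
theorem hasSum_coe_mul {σ : Type*} {w : σ → ℝ} (D : MvPolynomial σ ℝ)
    {φ : MvPowerSeries σ ℝ} {S : ℝ}
    (h : HasSum (fun m => MvPowerSeries.coeff m φ * monomialValue w m) S) :
    HasSum (fun m => MvPowerSeries.coeff m ((D : MvPowerSeries σ ℝ) * φ) * monomialValue w m)
      (MvPolynomial.eval w D * S) := by
  induction D using MvPolynomial.induction_on generalizing φ S with
  | C a =>
    simp only [MvPolynomial.coe_C, MvPowerSeries.coeff_C_mul, MvPolynomial.eval_C, mul_assoc]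
    exact h.mul_left a
  | add p q hp hq =>
    simp only [MvPolynomial.coe_add, add_mul, map_add]
    exact (hp h).add (hq h)
  | mul_X p s hp =>
    simp only [MvPolynomial.coe_mul, MvPolynomial.coe_X, mul_assoc, map_mul, MvPolynomial.eval_X]
    exact hp (hasSum_X_mul s h)

theorem hasSum_coe {σ : Type*} (w : σ → ℝ) (D : MvPolynomial σ ℝ) :
    HasSum (fun m => MvPowerSeries.coeff m (D : MvPowerSeries σ ℝ) * monomialValue w m)
      (MvPolynomial.eval w D) := by
  classical
  have h : HasSum (fun m => MvPowerSeries.coeff m (1 : MvPowerSeries σ ℝ) * monomialValue w m)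
      1 := by
    have := hasSum_single (f := fun m => MvPowerSeries.coeff m (1 : MvPowerSeries σ ℝ) *
      monomialValue w m) 0 (fun m hm => by simp [MvPowerSeries.coeff_one, hm])
    simpa [monomialValue] using this
  simpa using hasSum_coe_mul D h

/-- The words of length k contribute the k-th power of the sum of the weights, which leaves a
geometric series. -/
theorem summable_list_prod {E : Type*} [Fintype E] {w : E → ℝ} (hw : ∀ e, 0 ≤ w e)
    (hsum : ∑ e, w e < 1) : Summable fun P : List E => (P.map w).prod := by
  rw [← (List.equivSigmaTuple (α := E)).symm.summable_iff]
  have heq : (fun P : List E => (P.map w).prod) ∘ (List.equivSigmaTuple (α := E)).symm =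
      fun p : Σ k, Fin k → E => ∏ i, w (p.2 i) := by
    funext p
    simp [List.equivSigmaTuple, List.map_ofFn, List.prod_ofFn]
  rw [heq, summable_sigma_of_nonneg fun p => Finset.prod_nonneg fun i _ => hw _]
  refine ⟨fun k => (hasSum_fintype _).summable, ?_⟩
  have hk : (fun k => ∑' p : Fin k → E, ∏ i, w (p i)) = fun k => (∑ e, w e) ^ k := by
    classical
    funext k
    rw [tsum_fintype, Fintype.sum_pow]
  simp only [hk]
  exact summable_geometric_of_lt_one (Finset.sum_nonneg fun e _ => hw e) hsum

namespace PBDTPGraph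

theorem pathExponent_cons {E : Type*} (e : E) (P : List E) :
    pathExponent (e :: P) = Finsupp.single e 1 + pathExponent P := by simp [pathExponent]

open scoped Classical in
theorem flowMonomial_insert {E : Type*} {F : Finset E} {e : E} (he : e ∉ F) :
    flowMonomial (insert e F) = MvPolynomial.X e * flowMonomial F := by
  rw [flowMonomial, Finset.prod_insert he, flowMonomial]

/-- Every equation multiplies by a variable, so the vanishing of all coefficients of degree below k,
for all edges at once, propagates to degree k. -/
theorem eq_zero_of_recursion {E : Type*} {U : E → MvPowerSeries E ℝ} (a : E → ℝ) (b : E → E → ℝ)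
    (s : E → Finset E) (hU : ∀ e, U e = MvPowerSeries.C (a e) * (MvPowerSeries.X e *
      ∑ f ∈ s e, MvPowerSeries.C (b e f) * U f)) (e : E) : U e = 0 := by
  have key : ∀ k : ℕ, ∀ e : E, ∀ m : E →₀ ℕ, m.degree < k →
      MvPowerSeries.coeff m (U e) = 0 := by
    intro k
    induction k with
    | zero => intro e m h; exact absurd h (Nat.not_lt_zero _)
    | succ k ih =>
      intro e m hm
      rw [hU, MvPowerSeries.coeff_C_mul]
      by_cases h0 : m e = 0
      · rw [coeff_X_mul_of_eq_zero h0, mul_zero]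
      · obtain ⟨m, rfl⟩ := exists_single_add_of_ne_zero h0
        rw [coeff_single_add_X_mul, map_sum, Finset.sum_eq_zero, mul_zero]
        intro f _
        rw [MvPowerSeries.coeff_C_mul, ih f m, mul_zero]
        have : (Finsupp.single e 1 + m).degree = 1 + m.degree := by
          rw [map_add, Finsupp.degree_single]
        omega
  ext m
  rw [key (m.degree + 1) e m (Nat.lt_succ_self _), map_zero]

open scoped Classical in
theorem coeff_flowMonomial {E : Type*} (F : Finset E) (m : E →₀ ℕ) :
    MvPolynomial.coeff m (flowMonomial F) = if m = ∑ f ∈ F, Finsupp.single f 1 then 1 else 0 := by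
  have h : flowMonomial F = MvPolynomial.monomial (∑ f ∈ F, Finsupp.single f 1) 1 := by
    rw [flowMonomial, MvPolynomial.monomial_sum_one]
    rfl
  rw [h, MvPolynomial.coeff_monomial]
  simp only [eq_comm]

variable {n : ℕ} {V E : Type*} [Fintype V] [Fintype E] {G : PBDTPGraph n V E} {l : ℝ × ℝ}
  {j : Fin n}

theorem pathWeight_eq_monomialValue {E : Type*} (w : E → ℝ) (P : List E) :
    pathWeight w P = monomialValue w (pathExponent P) := by
  induction P with
  | nil => simp [pathWeight, pathExponent, monomialValue]
  | cons e P ih =>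
    rw [pathExponent_cons, monomialValue_single_add, ← ih]; simp [pathWeight]

/-! ### The linear relations between consecutive edges -/

open scoped Classical

theorem coeff_edgeVector (e : E) (m : E →₀ ℕ) :
    MvPowerSeries.coeff m (G.edgeVector l e j) =
      ∑ P ∈ (G.finite_walks e j m).toFinset, G.pathSign l P := rfl

theorem mem_walks {e : E} {m : E →₀ ℕ} {P : List E} :
    P ∈ (G.finite_walks e j m).toFinset ↔ G.IsWalk e j P ∧ pathExponent P = m := by simp

theorem sum_next_eq_zero {M : Type*} [AddCommMonoid M] {e : E} {i : Fin n}
    (he : G.tgt e = Sum.inl i) (X : E → M) : ∑ f with G.tgt e = G.src f, X f = 0 :=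
  Finset.sum_eq_zero fun f hf => by
    have h := (Finset.mem_filter.1 hf).2
    exact absurd (h.symm.trans he) (not_boundary_of_consecutive h i)

/-- The linear relation between the edge vectors at consecutive edges. -/
theorem edgeVector_eq (e : E) :
    G.edgeVector l e j = MvPowerSeries.C (G.edgeSign l e) * (MvPowerSeries.X e *
      ((if G.tgt e = Sum.inl j then 1 else 0) +
        ∑ f with G.tgt e = G.src f, MvPowerSeries.C (G.stepSign l e f) * G.edgeVector l f j)) := by
  ext m
  rw [MvPowerSeries.coeff_C_mul, coeff_edgeVector]
  by_cases hm : m e = 0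
  · rw [coeff_X_mul_of_eq_zero hm, mul_zero]
    refine Finset.sum_eq_zero fun P hP => ?_
    obtain ⟨hwalk, rfl⟩ := mem_walks.1 hP
    obtain ⟨P', rfl⟩ := hwalk.eq_cons
    rw [pathExponent_cons] at hm
    simp at hm
  obtain ⟨m, rfl⟩ := exists_single_add_of_ne_zero hm
  rw [coeff_single_add_X_mul, map_add, map_sum]
  simp only [MvPowerSeries.coeff_C_mul, coeff_edgeVector]
  rcases hv : G.tgt e with i | v
  · have hz := sum_next_eq_zero hv fun f => G.stepSign l e f *
      ∑ P ∈ (G.finite_walks f j m).toFinset, G.pathSign l P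
    rw [hv] at hz
    rw [hz, add_zero]
    have hwalk : ∀ P, G.IsWalk e j P ↔ P = [e] ∧ i = j := by
      intro P
      rw [isWalk_iff, hv]
      constructor
      · rintro (⟨h1, h2⟩ | ⟨f, P', -, h2, -⟩)
        · exact ⟨h1, Sum.inl_injective h2⟩
        · exact absurd h2.symm (not_boundary_of_consecutive (hv.trans h2) i)
      · rintro ⟨h1, rfl⟩
        exact Or.inl ⟨h1, rfl⟩
    by_cases hc : i = j ∧ m = 0
    · obtain ⟨rfl, rfl⟩ := hc
      have : (G.finite_walks e i (Finsupp.single e 1 + 0)).toFinset = {[e]} := by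
        ext P
        rw [mem_walks, hwalk, Finset.mem_singleton]
        constructor
        · rintro ⟨⟨h, -⟩, -⟩; exact h
        · rintro rfl; exact ⟨⟨rfl, rfl⟩, by simp [pathExponent]⟩
      rw [this, Finset.sum_singleton, pathSign_singleton, if_pos rfl]
      simp
    · rw [Finset.sum_eq_zero]
      · split_ifs with h
        · have h' : m ≠ 0 := fun hm => hc ⟨Sum.inl_injective h, hm⟩
          rw [MvPowerSeries.coeff_one, if_neg h', mul_zero]
        · simp
      · intro P hP
        rw [mem_walks, hwalk] at hP
        obtain ⟨⟨rfl, h1⟩, h2⟩ := hP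
        refine absurd ⟨h1, ?_⟩ hc
        rw [pathExponent_cons] at h2
        simpa [pathExponent] using (add_left_cancel h2).symm
  · rw [if_neg (by simp), map_zero, zero_add]
    simp only [Finset.mul_sum]
    rw [Finset.sum_sigma']
    symm
    refine Finset.sum_bij (fun q _ => e :: q.2) ?_ ?_ ?_ ?_
    · rintro ⟨f, P⟩ hq
      simp only [Finset.mem_sigma, Finset.mem_filter, Finset.mem_univ, true_and] at hq
      obtain ⟨hef, hP⟩ := hq
      obtain ⟨hwalk, rfl⟩ := mem_walks.1 hP
      exact mem_walks.2 ⟨isWalk_iff.2 (Or.inr ⟨f, P, rfl, hv.trans hef, hwalk⟩),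
        pathExponent_cons e P⟩
    · rintro ⟨f, P⟩ hq ⟨f', P'⟩ hq' h
      simp only [Finset.mem_sigma, Finset.mem_filter, Finset.mem_univ, true_and] at hq hq'
      obtain rfl : P = P' := (List.cons.inj h).2
      have h1 := (mem_walks.1 hq.2).1.1
      have h2 := (mem_walks.1 hq'.2).1.1
      obtain rfl : f = f' := Option.some.inj (h1.symm.trans h2)
      rfl
    · intro P hP
      obtain ⟨hP, hm⟩ := mem_walks.1 hP
      rcases isWalk_iff.1 hP with ⟨-, h⟩ | ⟨f, P', rfl, hef, hP'⟩
      · rw [hv] at h; simp at h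
      · rw [pathExponent_cons] at hm
        refine ⟨⟨f, P'⟩, ?_, rfl⟩
        simp only [Finset.mem_sigma, Finset.mem_filter, Finset.mem_univ, true_and]
        exact ⟨hv ▸ hef, mem_walks.2 ⟨hP', add_left_cancel hm⟩⟩
    · rintro ⟨f, P⟩ hq
      simp only [Finset.mem_sigma, Finset.mem_filter, Finset.mem_univ, true_and] at hq
      obtain ⟨P', rfl⟩ := (mem_walks.1 hq.2).1.eq_cons
      rw [pathSign_cons_cons, mul_assoc]

theorem mem_edgeFlows {e : E} {F : Finset E} :
    F ∈ (Finset.univ.filter fun F => G.IsEdgeFlow e j F) ↔ G.IsEdgeFlow e j F := by simp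

theorem edgeFlowSum_of_tgt_eq {e : E} (he : G.tgt e = Sum.inl j) :
    G.edgeFlowSum l e j =
      MvPolynomial.C (G.edgeSign l e) * (MvPolynomial.X e * G.conservativeSum) := by
  rw [edgeFlowSum, conservativeSum, Finset.mul_sum, Finset.mul_sum]
  symm
  refine Finset.sum_bij (fun C _ => insert e C) ?_ ?_ ?_ ?_
  · intro C hC
    exact mem_edgeFlows.2 (IsEdgeFlow.of_conservative he (Finset.mem_filter.1 hC).2)
  · intro C hC C' hC' h
    have h1 := IsEdgeFlow.not_mem_conservative he (Finset.mem_filter.1 hC).2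
    have h2 := IsEdgeFlow.not_mem_conservative he (Finset.mem_filter.1 hC').2
    rw [← Finset.erase_insert h1, h, Finset.erase_insert h2]
  · intro F hF
    have hF := mem_edgeFlows.1 hF
    exact ⟨F.erase e, by simpa using hF.erase_conservative he, Finset.insert_erase hF.1⟩
  · intro C hC
    have hC := (Finset.mem_filter.1 hC).2
    rw [flowSign_insert_conservative he hC,
      flowMonomial_insert (IsEdgeFlow.not_mem_conservative he hC)]

theorem edgeFlowSum_of_tgt_ne {e : E} {i : Fin n} (he : G.tgt e = Sum.inl i) (hij : i ≠ j) :
    G.edgeFlowSum l e j = 0 := by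
  rw [edgeFlowSum, Finset.filter_false_of_mem, Finset.sum_empty]
  intro F _ hF
  exact hij (hF.eq_of_tgt he)

/-- For a fixed F containing e the sum is empty or has exactly two terms: one edge of F arrives at
the end of e, hence two leave it. -/
theorem IsGaugeDirection.sum_flowSign_eq_zero (hl : G.IsGaugeDirection l) {e : E} {F : Finset E}
    (heF : e ∈ F) : ∑ f with G.tgt e = G.src f ∧ G.IsEdgeFlow f j F,
      G.stepSign l e f * G.flowSign l f j F = 0 := by
  rcases Finset.eq_empty_or_nonempty
    (Finset.univ.filter fun f => G.tgt e = G.src f ∧ G.IsEdgeFlow f j F) with h | ⟨f, hf⟩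
  · rw [h, Finset.sum_empty]
  obtain ⟨hef, hF⟩ := (Finset.mem_filter.1 hf).2
  rcases hv : G.src f with i | v
  · exact absurd hv (not_boundary_of_consecutive hef i)
  have hev := hef.trans hv
  have h1 := hF.2.2.1
  have h2 := hF.inCount_le_one v
  have h3 : 0 < G.inCount F (Sum.inr v) := hev ▸ inCount_pos heF
  rw [hv] at h1
  -- The flow conditions involve the first edge mainly through its initial vertex, so F is an edge
  -- flow from every one of its edges that leave v.
  have heq : (Finset.univ.filter fun f => G.tgt e = G.src f ∧ G.IsEdgeFlow f j F) =
      F.filter fun f => G.src f = Sum.inr v := by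
    ext g
    simp only [Finset.mem_filter, Finset.mem_univ, true_and, hev]
    constructor
    · rintro ⟨h4, h5⟩; exact ⟨h5.1, h4.symm⟩
    · rintro ⟨h4, h5⟩
      refine ⟨h5.symm, h4, fun u hu => hF.2.1 u ?_, ?_, hF.2.2.2.1, fun a ha i => ⟨fun h => ?_,
        (hF.2.2.2.2 a ha i).2⟩⟩
      · rw [hv, ← h5]; exact hu
      · rw [h5]; exact h1
      · obtain rfl := (hF.2.2.2.2 a ha i).1 h
        rw [hv] at h; simp at h
  have hcard : (F.filter fun f => G.src f = Sum.inr v).card = 2 := by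
    rw [← outCount_eq]; omega
  obtain ⟨a, b, hab, hs⟩ := Finset.card_eq_two.1 hcard
  have ha : a ∈ (Finset.univ.filter fun f => G.tgt e = G.src f ∧ G.IsEdgeFlow f j F) := by
    rw [heq, hs]; simp
  have hb : b ∈ (Finset.univ.filter fun f => G.tgt e = G.src f ∧ G.IsEdgeFlow f j F) := by
    rw [heq, hs]; simp
  have ha := (Finset.mem_filter.1 ha).2
  have hb := (Finset.mem_filter.1 hb).2
  rw [heq, hs, Finset.sum_pair hab]
  exact hl.flowSign_cancel ha.2 hb.2 hab ha.1 hb.1 heF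

/-- On the right-hand side the flows containing e cancel. Those avoiding e correspond, by adding e,
to the edge flows from e. -/
theorem IsGaugeDirection.edgeFlowSum_of_tgt_internal (hl : G.IsGaugeDirection l) {e : E} {v : V}
    (he : G.tgt e = Sum.inr v) :
    G.edgeFlowSum l e j = MvPolynomial.C (G.edgeSign l e) * (MvPolynomial.X e *
      ∑ f with G.tgt e = G.src f, MvPolynomial.C (G.stepSign l e f) * G.edgeFlowSum l f j) := by
  have hsplit : ∀ f, G.edgeFlowSum l f j =
      ∑ F with G.IsEdgeFlow f j F ∧ e ∉ F, MvPolynomial.C (G.flowSign l f j F) * flowMonomial F +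
      ∑ F with G.IsEdgeFlow f j F ∧ e ∈ F,
        MvPolynomial.C (G.flowSign l f j F) * flowMonomial F := by
    intro f
    rw [edgeFlowSum, ← Finset.sum_filter_add_sum_filter_not _ (fun F => e ∉ F),
      Finset.filter_filter, Finset.filter_filter]
    simp only [not_not]
  -- The order of summation is exchanged, so that the cancellation takes place for each F
  -- separately.
  have hzero : ∑ f with G.tgt e = G.src f, MvPolynomial.C (G.stepSign l e f) *
      ∑ F with G.IsEdgeFlow f j F ∧ e ∈ F,
        MvPolynomial.C (G.flowSign l f j F) * flowMonomial F = 0 := by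
    simp only [Finset.mul_sum]
    rw [Finset.sum_comm' (t' := Finset.univ.filter fun F => e ∈ F)
      (s' := fun F => Finset.univ.filter fun f => G.tgt e = G.src f ∧ G.IsEdgeFlow f j F)]
    · refine Finset.sum_eq_zero fun F hF => ?_
      have h := congrArg (fun x => MvPolynomial.C x * flowMonomial F)
        (hl.sum_flowSign_eq_zero (j := j) (Finset.mem_filter.1 hF).2)
      simp only [map_sum, map_mul, map_zero, zero_mul, Finset.sum_mul] at h
      rw [← h]
      exact Finset.sum_congr rfl fun f _ => (mul_assoc _ _ _).symm
    · intro f F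
      simp only [Finset.mem_filter, Finset.mem_univ, true_and]
      tauto
  simp only [hsplit, mul_add, Finset.sum_add_distrib] at hzero ⊢
  rw [hzero, mul_zero, mul_zero, add_zero, ← hsplit]
  rw [edgeFlowSum]
  simp only [Finset.mul_sum]
  rw [Finset.sum_sigma']
  symm
  refine Finset.sum_bij (fun q _ => insert e q.2) ?_ ?_ ?_ ?_
  · rintro ⟨f, F⟩ hq
    simp only [Finset.mem_sigma, Finset.mem_filter, Finset.mem_univ, true_and] at hq
    exact mem_edgeFlows.2 (hq.2.1.insert hq.1 hq.2.2)
  · rintro ⟨f, F⟩ hq ⟨f', F'⟩ hq' h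
    simp only [Finset.mem_sigma, Finset.mem_filter, Finset.mem_univ, true_and] at hq hq'
    simp only at h
    obtain rfl : F = F' := by
      rw [← Finset.erase_insert hq.2.2, h, Finset.erase_insert hq'.2.2]
    obtain rfl := (hq.2.1.insert hq.1 hq.2.2).next_unique (Finset.mem_insert_of_mem hq.2.1.1)
      (Finset.mem_insert_of_mem hq'.2.1.1) hq.1 hq'.1
    rfl
  · intro F hF
    have hF := mem_edgeFlows.1 hF
    obtain ⟨f, hef, hf⟩ := hF.exists_next he
    refine ⟨⟨f, F.erase e⟩, ?_, Finset.insert_erase hF.1⟩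
    simp only [Finset.mem_sigma, Finset.mem_filter, Finset.mem_univ, true_and]
    exact ⟨hef, hf, Finset.notMem_erase e F⟩
  · rintro ⟨f, F⟩ hq
    simp only [Finset.mem_sigma, Finset.mem_filter, Finset.mem_univ, true_and] at hq
    simp only
    rw [hq.2.1.flowSign_insert hq.1 hq.2.2, flowMonomial_insert hq.2.2, map_mul, map_mul]
    ring

/-- The linear relation between the sums over edge flows at consecutive edges. -/
theorem IsGaugeDirection.edgeFlowSum_eq (hl : G.IsGaugeDirection l) (e : E) :
    G.edgeFlowSum l e j = MvPolynomial.C (G.edgeSign l e) * (MvPolynomial.X e *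
      ((if G.tgt e = Sum.inl j then G.conservativeSum else 0) +
        ∑ f with G.tgt e = G.src f,
          MvPolynomial.C (G.stepSign l e f) * G.edgeFlowSum l f j)) := by
  rcases hv : G.tgt e with i | v
  · rw [← hv, sum_next_eq_zero hv, add_zero]
    by_cases hij : i = j
    · subst hij
      rw [if_pos hv, edgeFlowSum_of_tgt_eq hv]
    · rw [edgeFlowSum_of_tgt_ne hv hij, if_neg (fun h => hij (Sum.inl_injective (hv.symm.trans h))),
        mul_zero, mul_zero]
  · rw [← hv, hl.edgeFlowSum_of_tgt_internal hv, if_neg (by simp [hv]), zero_add]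

/-- Both sides solve the same inhomogeneous system, so their difference solves the homogeneous one.
-/
theorem IsGaugeDirection.conservativeSum_mul_edgeVector (hl : G.IsGaugeDirection l) (e : E) :
    (G.conservativeSum : MvPowerSeries E ℝ) * G.edgeVector l e j = G.edgeFlowSum l e j := by
  rw [← sub_eq_zero]
  refine eq_zero_of_recursion
    (U := fun e => (G.conservativeSum : MvPowerSeries E ℝ) * G.edgeVector l e j -
      G.edgeFlowSum l e j) (fun e => G.edgeSign l e) (fun e f => G.stepSign l e f)
    (fun e => Finset.univ.filter fun f => G.tgt e = G.src f) (fun e => ?_) e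
  have h1 := edgeVector_eq (G := G) (l := l) (j := j) e
  have h2 := congrArg (MvPolynomial.coeToMvPowerSeries.ringHom (R := ℝ))
    (hl.edgeFlowSum_eq (j := j) e)
  simp only [map_mul, map_add, map_sum, MvPolynomial.coeToMvPowerSeries.ringHom_apply,
    MvPolynomial.coe_C, MvPolynomial.coe_X] at h2
  simp only [mul_sub, Finset.sum_sub_distrib]
  have h3 : ∑ f with G.tgt e = G.src f, MvPowerSeries.C (G.stepSign l e f) *
      ((G.conservativeSum : MvPowerSeries E ℝ) * G.edgeVector l f j) =
      (G.conservativeSum : MvPowerSeries E ℝ) *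
        ∑ f with G.tgt e = G.src f, MvPowerSeries.C (G.stepSign l e f) * G.edgeVector l f j := by
    rw [Finset.mul_sum]
    exact Finset.sum_congr rfl fun f _ => by ring
  have h4 : ((if G.tgt e = Sum.inl j then G.conservativeSum else 0 : MvPolynomial E ℝ) :
      MvPowerSeries E ℝ) = G.conservativeSum * if G.tgt e = Sum.inl j then 1 else 0 := by
    split_ifs <;> simp
  rw [h3]
  rw [h4] at h2
  rw [h1, h2]
  ring

/-! ### The denominator, and evaluation of the series at positive weights -/

theorem isConservativeFlow_empty : G.IsConservativeFlow ∅ := by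
  simp [IsConservativeFlow, inCount, outCount]

theorem coeff_conservativeSum_nonneg (m : E →₀ ℕ) :
    0 ≤ MvPolynomial.coeff m G.conservativeSum := by
  rw [conservativeSum, MvPolynomial.coeff_sum]
  refine Finset.sum_nonneg fun C _ => ?_
  rw [coeff_flowMonomial]
  split_ifs <;> norm_num

theorem constantCoeff_conservativeSum : MvPolynomial.constantCoeff G.conservativeSum = 1 := by
  rw [conservativeSum, map_sum, Finset.sum_eq_single ∅]
  · simp [flowMonomial]
  · intro C _ hC
    obtain ⟨f, hf⟩ := Finset.nonempty_iff_ne_empty.2 hC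
    rw [flowMonomial, map_prod, Finset.prod_eq_zero hf (by simp)]
  · intro h
    exact absurd (Finset.mem_filter.2 ⟨Finset.mem_univ _, isConservativeFlow_empty⟩) h

theorem eval_conservativeSum_pos {w : E → ℝ} (hw : ∀ f, 0 < w f) :
    0 < MvPolynomial.eval w G.conservativeSum := by
  rw [conservativeSum, map_sum]
  have hF : ∀ F : Finset E, MvPolynomial.eval w (flowMonomial F) = ∏ f ∈ F, w f := fun F => by
    simp [flowMonomial, map_prod]
  refine Finset.sum_pos (fun C _ => ?_)
    ⟨∅, Finset.mem_filter.2 ⟨Finset.mem_univ _, isConservativeFlow_empty⟩⟩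
  rw [hF]
  exact Finset.prod_pos fun f _ => hw f

/-- The sum over walks is regrouped by exponents; each group is finite and sums to one term of the
power series. -/
theorem hasSum_edgeVector {w : E → ℝ} {e : E} {S : ℝ}
    (h : HasSum (fun P : {P : List E // G.IsWalk e j P} => G.pathSign l P * pathWeight w P) S) :
    HasSum (fun m => MvPowerSeries.coeff m (G.edgeVector l e j) * monomialValue w m) S := by
  have hs := ((Equiv.sigmaFiberEquiv
    fun P : {P : List E // G.IsWalk e j P} => pathExponent P.1).hasSum_iff).2 h
  refine hs.sigma fun m => ?_
  let φ : {P : {P : List E // G.IsWalk e j P} // pathExponent P.1 = m} ≃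
      {P // P ∈ (G.finite_walks e j m).toFinset} :=
    { toFun := fun P => ⟨P.1.1, mem_walks.2 ⟨P.1.2, P.2⟩⟩
      invFun := fun P => ⟨⟨P.1, (mem_walks.1 P.2).1⟩, (mem_walks.1 P.2).2⟩
      left_inv := fun _ => rfl
      right_inv := fun _ => rfl }
  have h1 := (φ.hasSum_iff).2 ((G.finite_walks e j m).toFinset.hasSum
    fun P => G.pathSign l P * pathWeight w P)
  have h2 : ∑ P ∈ (G.finite_walks e j m).toFinset, G.pathSign l P * pathWeight w P =
      MvPowerSeries.coeff m (G.edgeVector l e j) * monomialValue w m := by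
    rw [coeff_edgeVector, Finset.sum_mul]
    refine Finset.sum_congr rfl fun P hP => ?_
    rw [pathWeight_eq_monomialValue, (mem_walks.1 hP).2]
  rw [h2] at h1
  exact h1

end PBDTPGraph

end

theorem mainTheorem3 {n : ℕ} {V E : Type*} [Fintype V] [Fintype E]
    (G : PBDTPGraph n V E) (l : ℝ × ℝ) (hl : G.IsGaugeDirection l) (e : E) (j : Fin n) :
    -- every edge flow has exactly one edge loop-erased walk, so that its sign is well defined
    (∀ F, G.IsEdgeFlow e j F → ∃! P, G.IsFlowWalk e j F P) ∧
    -- the denominator is subtraction-free, with constant term one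
    (∀ m, 0 ≤ MvPolynomial.coeff m G.conservativeSum) ∧
    MvPolynomial.constantCoeff G.conservativeSum = 1 ∧
    -- the formula, as an identity of formal power series in the edge weights
    G.edgeVector l e j =
      (G.edgeFlowSum l e j : MvPowerSeries E ℝ) * (G.conservativeSum : MvPowerSeries E ℝ)⁻¹ ∧
    -- the formula for the value of the component at arbitrary positive weights
    (∀ w : E → ℝ, (∀ f, 0 < w f) →
      0 < MvPolynomial.eval w G.conservativeSum ∧
      ∀ x, PBDTPGraph.IsRationalValue (G.edgeVector l e j) w x ↔
        x = MvPolynomial.eval w (G.edgeFlowSum l e j) / MvPolynomial.eval w G.conservativeSum) ∧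
    -- the formula for the sum over walks at all positive weights where it converges
    (∀ w : E → ℝ, (∀ f, 0 < w f) →
      Summable (fun P : {P : List E // G.IsWalk e j P} =>
        G.pathSign l P * PBDTPGraph.pathWeight w P) →
      HasSum (fun P : {P : List E // G.IsWalk e j P} =>
          G.pathSign l P * PBDTPGraph.pathWeight w P)
        (MvPolynomial.eval w (G.edgeFlowSum l e j) / MvPolynomial.eval w G.conservativeSum)) ∧
    -- it converges at all sufficiently small positive weights
    (∃ ε : ℝ, 0 < ε ∧ ∀ w : E → ℝ, (∀ f, 0 < w f ∧ w f < ε) →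
      Summable (fun P : {P : List E // G.IsWalk e j P} =>
        G.pathSign l P * PBDTPGraph.pathWeight w P)) := by
  have hD := hl.conservativeSum_mul_edgeVector (j := j) e
  have hC : MvPowerSeries.constantCoeff (G.conservativeSum : MvPowerSeries E ℝ) ≠ 0 := by
    have h : MvPowerSeries.constantCoeff (G.conservativeSum : MvPowerSeries E ℝ) =
        MvPolynomial.constantCoeff G.conservativeSum := rfl
    rw [h, PBDTPGraph.constantCoeff_conservativeSum]
    exact one_ne_zero
  refine ⟨fun F hF => hF.existsUnique_flowWalk, PBDTPGraph.coeff_conservativeSum_nonneg,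
    PBDTPGraph.constantCoeff_conservativeSum, ?_, fun w hw => ?_, fun w hw hsum => ?_, ?_⟩
  · rw [MvPowerSeries.eq_mul_inv_iff_mul_eq hC, mul_comm, hD]
  · have hpos := PBDTPGraph.eval_conservativeSum_pos (G := G) hw
    refine ⟨hpos, fun x => ⟨?_, ?_⟩⟩
    · rintro ⟨p, q, hpq, hq, rfl⟩
      -- Any two fractions representing the series agree after cross-multiplication as polynomials,
      -- which makes the value independent of the representation.
      have h : q * G.edgeFlowSum l e j = p * G.conservativeSum := by
        apply MvPolynomial.coe_injective E ℝ
        rw [MvPolynomial.coe_mul, MvPolynomial.coe_mul, ← hD, ← hpq]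
        ring
      have h' := congrArg (MvPolynomial.eval w) h
      rw [map_mul, map_mul] at h'
      rw [div_eq_div_iff hq hpos.ne', ← h', mul_comm]
    · rintro rfl
      exact ⟨_, _, hD, hpos.ne', rfl⟩
  · have hpos := PBDTPGraph.eval_conservativeSum_pos (G := G) hw
    obtain ⟨S, hS⟩ := hsum
    -- Multiplying the convergent sum S by the denominator gives a series of value D(w)·S whose
    -- terms are those of the numerator polynomial.
    have h1 := hasSum_coe_mul G.conservativeSum (PBDTPGraph.hasSum_edgeVector hS)
    rw [hD] at h1
    have h2 := h1.unique (hasSum_coe w (G.edgeFlowSum l e j))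
    rwa [← h2, mul_div_cancel_left₀ _ hpos.ne']
  -- This bound makes the sum of all weights less than 1, and the extra 1 keeps it meaningful when
  -- there are no edges.
  · refine ⟨1 / (Fintype.card E + 1), by positivity, fun w hw => ?_⟩
    have hE : (0 : ℝ) < Fintype.card E + 1 := by positivity
    have hlt : ∑ f, w f < 1 := by
      have h1 : ∑ f, w f ≤ ∑ _f : E, 1 / ((Fintype.card E : ℝ) + 1) :=
        Finset.sum_le_sum fun f _ => (hw f).2.le
      refine h1.trans_lt ?_
      rw [Finset.sum_const, Finset.card_univ, nsmul_eq_mul, mul_one_div, div_lt_one hE]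
      exact lt_add_one _
    have hsum := (summable_list_prod (fun f => (hw f).1.le) hlt).comp_injective
      (Subtype.val_injective (p := fun P : List E => G.IsWalk e j P))
    refine Summable.of_norm_bounded hsum fun P => ?_
    rw [Real.norm_eq_abs, abs_mul, PBDTPGraph.abs_pathSign, one_mul]
    have h0 : 0 ≤ PBDTPGraph.pathWeight w P.1 := List.prod_nonneg (by
      intro a ha
      obtain ⟨f, -, rfl⟩ := List.mem_map.1 ha
      exact (hw f).1.le)
    rw [abs_of_nonneg h0]
    exact le_rfl
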